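/- Let $(M,g)$ be a closed (compact, without boundary) smooth Riemannian manifold with Riemannian volume $d\nu$, let $f\in C^2(M)$, and put $d\mu=e^{-f}d\nu$. Let $1<p<\infty$, $a<b$, let $\eta:[a,b]\to\mathbb R$ be smooth, and let $m\in\mathbb N$. For $v=(v_1,\dots,v_m):M\to\mathbb R^m$ write $|\nabla v|^2=\sum_k|\nabla v_k|^2$ and $$\Delta_{f,p}v=\operatorname{div}_f\big(|\nabla v|^{p-2}\nabla v\big),\qquad \operatorname{div}_f Y=e^{f}\operatorname{div}(e^{-f}Y),$$ applied to each component. Let $u:M\times[a,b]\to\mathbb R^m$ be a smooth (classical) solution of $$|u|^{p-2}u_t-\Delta_{f,p}u=\eta(t)\,|u|^{p-2}u .$$ (If $1<p<2$, this includes that for each $t$ the fields $|\nabla u|^{p-2}\nabla u_k$, set to $0$ where $\nabla u=0$, are $C^1$ on $M$, so that $\Delta_{f,p}u$ is defined; and the equation is imposed only where $u\neq0$. If $p\ge 2$ nothing beyond smoothness of $u$ is required and the equation holds on all of $M\times[a,b]$.) Put $$I_p(t)=\int_M|u|^p\,d\mu,\qquad D_p(t)=\int_M\langle u,\Delta_{f,p}u\rangle\,d\mu,\qquad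 U_p(t)=\frac{D_p(t)}{I_p(t)} .$$ Then $$I_p(b)\ \ge\ I_p(a)\,\exp\Big(p\int_a^b\eta(t)\,dt+p\,U_p(a)\,(b-a)\Big),$$ where the right-hand side is read as $0$ if $I_p(a)=0$. -/

import Mathlib

open Set MeasureTheory Bundle
open scoped Manifold ContDiff Bundle ENNReal

noncomputable section

namespace PFrequency

section Geometry

variable {n : ℕ} {M : Type*} [TopologicalSpace M] [ChartedSpace (EuclideanSpace ℝ (Fin n)) M]
  [IsManifold (𝓡 n) ∞ M] [RiemannianBundle (fun x : M ↦ TangentSpace (𝓡 n) x)]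

/-- The coordinate vector field `∂ᵢ` of the preferred chart at `x₀`, at the point of `M` with
coordinates `z`. -/
def coordVec (x₀ : M) (z : EuclideanSpace ℝ (Fin n)) (i : Fin n) :
    TangentSpace (𝓡 n) ((extChartAt (𝓡 n) x₀).symm z) :=
  mfderiv 𝓘(ℝ, EuclideanSpace ℝ (Fin n)) (𝓡 n) (extChartAt (𝓡 n) x₀).symm z
    (EuclideanSpace.single i (1 : ℝ) : EuclideanSpace ℝ (Fin n))

/-- The matrix `g_{ij}(z) = ⟨∂ᵢ, ∂ⱼ⟩` of the metric in the preferred chart at `x₀`. -/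
def gram (x₀ : M) (z : EuclideanSpace ℝ (Fin n)) : Matrix (Fin n) (Fin n) ℝ :=
  Matrix.of fun i j ↦ inner ℝ (coordVec x₀ z i) (coordVec x₀ z j)

/-- The volume density `√(det g_{ij}(z))` in the preferred chart at `x₀`. -/
def volDensity (x₀ : M) (z : EuclideanSpace ℝ (Fin n)) : ℝ :=
  Real.sqrt (gram x₀ z).det

/-- The measure `√(det g_{ij}) dz¹ ⋯ dzⁿ` of the preferred chart at `x₀`, carried to the domain
of that chart in `M`. -/
def chartVolume [MeasurableSpace M] (x₀ : M) : Measure M :=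
  ((volume.restrict (extChartAt (𝓡 n) x₀).target).withDensity
    (fun z ↦ ENNReal.ofReal (volDensity x₀ z))).map (extChartAt (𝓡 n) x₀).symm

variable (n M) in
/-- The Riemannian volume measure `dν`: since the chart measures agree on overlaps, it is the
smallest measure that dominates all of them. -/
def riemannianVolume [MeasurableSpace M] : Measure M :=
  ⨆ x₀ : M, chartVolume (n := n) x₀

variable (n) in
/-- The weighted volume measure `dμ = e^{-f} dν`. -/
def weightedVolume [MeasurableSpace M] (f : M → ℝ) : Measure M :=
  (riemannianVolume n M).withDensity (fun x ↦ ENNReal.ofReal (Real.exp (-f x)))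

/-- The gradient `∇h` of a real function: the vector representing `dh` in the metric. -/
def grad (h : M → ℝ) (x : M) : TangentSpace (𝓡 n) x :=
  haveI : FiniteDimensional ℝ (TangentSpace (𝓡 n) x) :=
    inferInstanceAs (FiniteDimensional ℝ (EuclideanSpace ℝ (Fin n)))
  haveI : CompleteSpace (TangentSpace (𝓡 n) x) := FiniteDimensional.complete ℝ _
  (InnerProductSpace.toDual ℝ (TangentSpace (𝓡 n) x)).symm
    (mfderiv (𝓡 n) 𝓘(ℝ, ℝ) h x : TangentSpace (𝓡 n) x →L[ℝ] ℝ)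

/-- The components `(Y¹, …, Yⁿ)` of a vector field in the preferred chart at `x₀`, as functions
of the coordinates `z`. -/
def coordComp (Y : ∀ x : M, TangentSpace (𝓡 n) x) (x₀ : M) (z : EuclideanSpace ℝ (Fin n)) :
    EuclideanSpace ℝ (Fin n) :=
  mfderiv (𝓡 n) 𝓘(ℝ, EuclideanSpace ℝ (Fin n)) (extChartAt (𝓡 n) x₀)
    ((extChartAt (𝓡 n) x₀).symm z) (Y ((extChartAt (𝓡 n) x₀).symm z))

/-- The Riemannian divergence `div Y = (det g)^{-1/2} ∑ᵢ ∂ᵢ ((det g)^{1/2} Yⁱ)`, computed at `x` in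
the preferred chart at `x`. -/
def divergence (Y : ∀ x : M, TangentSpace (𝓡 n) x) (x : M) : ℝ :=
  (volDensity x (extChartAt (𝓡 n) x x))⁻¹ *
    ∑ i : Fin n, fderiv ℝ (fun z ↦ volDensity x z * coordComp Y x z i) (extChartAt (𝓡 n) x x)
      (EuclideanSpace.single i (1 : ℝ))

/-- The weighted divergence `div_f Y = e^f div (e^{-f} Y)`. -/
def weightedDivergence (f : M → ℝ) (Y : ∀ x : M, TangentSpace (𝓡 n) x) (x : M) : ℝ :=
  Real.exp (f x) * divergence (fun y ↦ Real.exp (-f y) • Y y) x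

variable {m : ℕ}

/-- `|∇v| = (∑ₖ |∇vₖ|²)^{1/2}` for `v : M → ℝᵐ`; it is the norm of the gradient if `m = 1`. -/
def gradNorm (v : M → EuclideanSpace ℝ (Fin m)) (x : M) : ℝ :=
  Real.sqrt (∑ k : Fin m, ‖grad (n := n) (fun y ↦ v y k) x‖ ^ 2)

/-- The `k`-th component `|∇v|^{p-2} ∇vₖ` of the flux; it is `0` where `∇v = 0`. -/
def pFlux (p : ℝ) (v : M → EuclideanSpace ℝ (Fin m)) (k : Fin m) (x : M) : TangentSpace (𝓡 n) x :=
  gradNorm (n := n) v x ^ (p - 2) • grad (n := n) (fun y ↦ v y k) x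

variable (n) in
/-- The weighted `p`-Laplacian `Δ_{f,p} v = div_f (|∇v|^{p-2} ∇v)`, component by component. -/
def weightedPLaplacian (p : ℝ) (f : M → ℝ) (v : M → EuclideanSpace ℝ (Fin m)) (x : M) :
    EuclideanSpace ℝ (Fin m) :=
  WithLp.toLp 2 fun k ↦ weightedDivergence (n := n) f (pFlux (n := n) p v k) x

variable (n) in
/-- `u` is a smooth function on `M × [a, b]` with values in `ℝᵐ` that solves
`|u|^{p-2} u_t - Δ_{f,p} u = η(t) |u|^{p-2} u`. -/
structure IsPHeatSolution (p : ℝ) (f : M → ℝ) (η : ℝ → ℝ) (a b : ℝ)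
    (u : M → ℝ → EuclideanSpace ℝ (Fin m)) : Prop where
  smooth : ContMDiffOn ((𝓡 n).prod 𝓘(ℝ, ℝ)) 𝓘(ℝ, EuclideanSpace ℝ (Fin m)) ∞
    (fun q : M × ℝ ↦ u q.1 q.2) (univ ×ˢ Icc a b)
  /-- For `p < 2` the field `|∇u|^{p-2} ∇u` need not be differentiable at the zeros of `∇u`; that
  the equation has a meaning there is part of being a solution. For `p ≥ 2` nothing is asked. -/
  flux_contMDiff : p < 2 → ∀ t ∈ Icc a b, ∀ k : Fin m,
    ContMDiff (𝓡 n) (𝓡 n).tangent 1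
      (fun x ↦ (⟨x, pFlux p (fun y ↦ u y t) k x⟩ : TangentBundle (𝓡 n) M))
  /-- For `p < 2` the term `|u|^{p-2} u_t` has no meaning at the zeros of `u`, so the equation is
  not imposed at those points. -/
  equation : ∀ t ∈ Icc a b, ∀ x : M, (2 ≤ p ∨ u x t ≠ 0) →
    ‖u x t‖ ^ (p - 2) • derivWithin (fun s ↦ u x s) (Icc a b) t
        - weightedPLaplacian n p f (fun y ↦ u y t) x
      = (η t * ‖u x t‖ ^ (p - 2)) • u x t

variable (n) in
/-- `I_p(t) = ∫_M |u|^p dμ`. -/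
def Ip [MeasurableSpace M] (p : ℝ) (f : M → ℝ) (u : M → ℝ → EuclideanSpace ℝ (Fin m)) (t : ℝ) : ℝ :=
  ∫ x, ‖u x t‖ ^ p ∂(weightedVolume n f)

variable (n) in
/-- `D_p(t) = ∫_M ⟨u, Δ_{f,p} u⟩ dμ`. -/
def Dp [MeasurableSpace M] (p : ℝ) (f : M → ℝ) (u : M → ℝ → EuclideanSpace ℝ (Fin m)) (t : ℝ) : ℝ :=
  ∫ x, inner ℝ (u x t) (weightedPLaplacian n p f (fun y ↦ u y t) x) ∂(weightedVolume n f)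

variable (n) in
/-- The parabolic frequency `U_p(t) = D_p(t) / I_p(t)`. -/
def Up [MeasurableSpace M] (p : ℝ) (f : M → ℝ) (u : M → ℝ → EuclideanSpace ℝ (Fin m)) (t : ℝ) : ℝ :=
  Dp n p f u t / Ip n p f u t

end Geometry

end PFrequency

end

/-! Write I, D and U = D/I for the three quantities. Pairing the equation with u gives I' = p(D +
ηI), so (log I)' = p(η + U) wherever I > 0. If U is nondecreasing, then U ≥ U(a) and the bound
follows by integration. The same estimate keeps I positive when I(a) > 0: at a first zero c of I it
would give I(a) ≤ 0.

The monotonicity of U does not come from differentiating D, since the power of |∇u| is singular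
where ∇u = 0. Convexity replaces this. By Green's formula -D(t) = ∫ |∇u(t)|^p dμ, a convex
p-homogeneous functional of u(t), and its tangent inequality at u(s)
(`integral_inner_weightedPLaplacian_le`) says that D(t) ≤ R(t), where R(t) = D(s) + p ∫ ⟨Δ_{f,p}
u(s), u(t) - u(s)⟩ dμ. Hence R/I touches U from above at s. It is differentiable there, with
derivative p (J I - D (D + ηI)) / I², where J = ∫ ⟨Δ_{f,p} u, u_t⟩ dμ. Since Δ_{f,p} u = |u|^{p-2}
(u_t - ηu), this is nonnegative by Cauchy-Schwarz with weight |u|^{p-2}, and `le_of_touching` turns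
it into monotonicity. `growth_of_evolution` contains the whole argument in abstract form.

For p < 2 the equation is not imposed where u = 0. Almost everywhere on that set Δ_{f,p} u = 0
(`ae_weightedDivergence_pFlux_eq_zero`), because a differentiable function has zero derivative at
almost all of its zeros.

The remaining work is Green's formula for fields that are only differentiable with continuous
divergence. The volume is a supremum of chart measures and the divergence at a point uses the chart
at that point; `volDensity_transition` and `trace_fderiv_of_piola` make both independent of the
chart, after which a partition of unity reduces the divergence theorem to Euclidean space. -/

noncomputable section

namespace PFrequency

open Filter Topology

/-! ### Calculus in a finite-dimensional space: Jacobians, zero sets, powers of norms. -/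

section Euclidean

variable {E : Type*} [NormedAddCommGroup E] [NormedSpace ℝ E] [FiniteDimensional ℝ E]

theorem contDiff_clm_det : ContDiff ℝ ∞ (fun A : E →L[ℝ] E ↦ A.det) := by
  classical
  let b := Module.finBasis ℝ E
  have h : (fun A : E →L[ℝ] E ↦ A.det) =
      fun A : E →L[ℝ] E ↦ (LinearMap.toMatrix b b (A : E →ₗ[ℝ] E)).det := by
    funext A
    rw [LinearMap.det_toMatrix]
  rw [h]
  simp only [Matrix.det_apply]
  refine ContDiff.sum fun σ _ ↦ ?_
  refine ContDiff.const_smul _ (contDiff_prod fun i _ ↦ ?_)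
  simp only [LinearMap.toMatrix_apply]
  let l : (E →L[ℝ] E) →ₗ[ℝ] ℝ :=
    { toFun := fun A ↦ b.repr (A (b i)) (σ i)
      map_add' := fun A B ↦ by simp
      map_smul' := fun c A ↦ by simp }
  exact (LinearMap.toContinuousLinearMap l).contDiff

/-- Jacobi's formula. -/
theorem fderiv_clm_det (A : E ≃L[ℝ] E) (B : E →L[ℝ] E) :
    fderiv ℝ (fun A : E →L[ℝ] E ↦ A.det) (A : E →L[ℝ] E) B =
      (A : E →L[ℝ] E).det *
        LinearMap.trace ℝ E (((A.symm : E →L[ℝ] E) ∘L B : E →L[ℝ] E) : E →ₗ[ℝ] E) := by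
  classical
  let b := Module.finBasis ℝ E
  set C : E →L[ℝ] E := (A.symm : E →L[ℝ] E) ∘L B with hC
  have hd : DifferentiableAt ℝ (fun A : E →L[ℝ] E ↦ A.det) (A : E →L[ℝ] E) :=
    contDiff_clm_det.differentiable (by simp) _
  have h1 : HasDerivAt (fun t : ℝ ↦ ((A : E →L[ℝ] E) + t • B).det)
      (fderiv ℝ (fun A : E →L[ℝ] E ↦ A.det) (A : E →L[ℝ] E) B) 0 := by
    have hl : HasDerivAt (fun t : ℝ ↦ (A : E →L[ℝ] E) + t • B) B 0 := by
      simpa using ((hasDerivAt_id (0 : ℝ)).smul_const B).const_add (A : E →L[ℝ] E)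
    have hd' : HasFDerivAt (fun A : E →L[ℝ] E ↦ A.det)
        (fderiv ℝ (fun A : E →L[ℝ] E ↦ A.det) (A : E →L[ℝ] E))
        ((A : E →L[ℝ] E) + (0 : ℝ) • B) := by
      simpa using hd.hasFDerivAt
    exact hd'.comp_hasDerivAt (0 : ℝ) hl
  set M := LinearMap.toMatrix b b (C : E →ₗ[ℝ] E) with hM
  -- Factoring A + tB = A (1 + tC) with C = A⁻¹B reduces the derivative to that of det (1 + tM) at t
  -- = 0.
  have h2 : ∀ t : ℝ, ((A : E →L[ℝ] E) + t • B).det =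
      (A : E →L[ℝ] E).det * (1 + t • M).det := by
    intro t
    have e1 : (A : E →L[ℝ] E) + t • B =
        (A : E →L[ℝ] E) ∘L (ContinuousLinearMap.id ℝ E + t • C) := by
      ext x
      simp [hC]
    have e2 : (1 + t • M : Matrix _ _ ℝ) =
        LinearMap.toMatrix b b ((ContinuousLinearMap.id ℝ E + t • C : E →L[ℝ] E) : E →ₗ[ℝ] E) := by
      rw [hM, ContinuousLinearMap.toLinearMap_add, ContinuousLinearMap.toLinearMap_smul, map_add,
        map_smul, ContinuousLinearMap.coe_id, LinearMap.toMatrix_id]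
    rw [e1, e2, LinearMap.det_toMatrix]
    change LinearMap.det _ = LinearMap.det _ * _
    rw [ContinuousLinearMap.toLinearMap_comp, LinearMap.det_comp]
  have h3 : HasDerivAt (fun t : ℝ ↦ ((A : E →L[ℝ] E) + t • B).det)
      ((A : E →L[ℝ] E).det * M.trace) 0 := by
    rw [funext h2]
    refine HasDerivAt.const_mul _ ?_
    -- det (1 + tM) = 1 + t tr M + t² P(t) for a polynomial P, and the last term has zero derivative
    -- at 0 whatever P is.
    rw [funext fun t ↦ Matrix.det_one_add_smul t M]
    set P := (Matrix.det (1 + (Polynomial.X : Polynomial ℝ) • M.map Polynomial.C)).divX.divX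
    have a1 : HasDerivAt (fun t : ℝ ↦ 1 + M.trace * t) M.trace 0 := by
      simpa using ((hasDerivAt_id (0 : ℝ)).const_mul M.trace).const_add 1
    have a2 := (P.hasDerivAt 0).mul ((hasDerivAt_id (0 : ℝ)).pow 2)
    refine (a1.add a2).congr_deriv ?_
    simp
  rw [h1.unique h3, hM, LinearMap.trace_eq_matrix_trace ℝ b]

/-- The divergence of a vector density is invariant under changes of coordinates. -/
theorem trace_fderiv_of_piola {ψ V W : E → E} {z : E} (hψ : ContDiffAt ℝ 2 ψ z)
    (A : E ≃L[ℝ] E) (hA : fderiv ℝ ψ z = A) (hV : DifferentiableAt ℝ V z)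
    (hW : DifferentiableAt ℝ W (ψ z))
    (h : ∀ᶠ y in 𝓝 z, |(fderiv ℝ ψ y).det| • W (ψ y) = fderiv ℝ ψ y (V y)) :
    |(A : E →L[ℝ] E).det| * LinearMap.trace ℝ E (fderiv ℝ W (ψ z) : E →ₗ[ℝ] E) =
      LinearMap.trace ℝ E (fderiv ℝ V z : E →ₗ[ℝ] E) := by
  set d := (A : E →L[ℝ] E).det with hd
  have hd0 : d ≠ 0 := by
    have : IsUnit d := by
      have := LinearEquiv.isUnit_det' (A : E ≃ₗ[ℝ] E)
      exact this
    exact this.ne_zero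
  have hψ1 : DifferentiableAt ℝ (fderiv ℝ ψ) z :=
    (hψ.fderiv_right (m := 1) (by norm_num)).differentiableAt (by simp)
  have hψ0 : DifferentiableAt ℝ ψ z := hψ.differentiableAt (by simp)
  set H := fderiv ℝ (fderiv ℝ ψ) z with hH
  have hsymm : ∀ x y, H x y = H y x := by
    have : IsSymmSndFDerivAt ℝ ψ z := hψ.isSymmSndFDerivAt (by simp)
    exact fun x y ↦ this x y
  let T : E → ℝ := fun x ↦
    LinearMap.trace ℝ E (((A.symm : E →L[ℝ] E) ∘L H x : E →L[ℝ] E) : E →ₗ[ℝ] E)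
  -- the derivative of the Jacobian
  have hdet : HasFDerivAt (fun y ↦ (fderiv ℝ ψ y).det)
      ((fderiv ℝ (fun B : E →L[ℝ] E ↦ B.det) (A : E →L[ℝ] E)) ∘L H) z := by
    have h1 : HasFDerivAt (fun B : E →L[ℝ] E ↦ B.det)
      (fderiv ℝ (fun B : E →L[ℝ] E ↦ B.det) (A : E →L[ℝ] E)) (fderiv ℝ ψ z) := by
      rw [hA]
      exact (contDiff_clm_det.differentiable (by simp) _).hasFDerivAt
    exact h1.comp z hψ1.hasFDerivAt
  obtain ⟨δ', hδ, hδ'⟩ : ∃ δ' : E →L[ℝ] ℝ,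
      HasFDerivAt (fun y ↦ |(fderiv ℝ ψ y).det|) δ' z ∧ ∀ x, δ' x = |d| * T x := by
    have hz : (fderiv ℝ ψ z).det = d := by rw [hA]
    rcases lt_or_gt_of_ne hd0 with hneg | hpos
    · have := hdet.abs_of_neg (by rw [hz]; exact hneg)
      refine ⟨_, this, fun x ↦ ?_⟩
      simp only [_root_.neg_apply, ContinuousLinearMap.comp_apply]
      rw [fderiv_clm_det, abs_of_neg hneg, ← hd]
      ring
    · have := hdet.abs_of_pos (by rw [hz]; exact hpos)
      refine ⟨_, this, fun x ↦ ?_⟩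
      simp only [ContinuousLinearMap.comp_apply]
      rw [fderiv_clm_det, abs_of_pos hpos, ← hd]
  have hW' : HasFDerivAt (fun y ↦ W (ψ y)) ((fderiv ℝ W (ψ z)) ∘L (A : E →L[ℝ] E)) z := by
    rw [← hA]
    exact hW.hasFDerivAt.comp z hψ0.hasFDerivAt
  have hL := hδ.smul hW'
  have hR := hψ1.hasFDerivAt.clm_apply hV.hasFDerivAt
  have heq := hL.unique (hR.congr_of_eventuallyEq h)
  have hz := h.self_of_nhds
  rw [hA] at hz
  have hV' : V z = |d| • A.symm (W (ψ z)) := by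
    have := congrArg A.symm hz
    simp only [ContinuousLinearEquiv.coe_coe, ContinuousLinearEquiv.symm_apply_apply,
      map_smul] at this
    exact this.symm
  -- This is the derivative of the hypothesis at z, multiplied by A⁻¹. The symmetry of H turns
  -- H(x)(V z) into H(V z)(x), so both sides are endomorphisms in x whose traces can be taken. The
  -- two terms without DW or DV then cancel: by Jacobi's formula the left one has trace |d| T(A⁻¹
  -- W), and V z = |d| A⁻¹ W.
  have hlin : (|d| • (A.symm : E ≃ₗ[ℝ] E).conj (fderiv ℝ W (ψ z) : E →ₗ[ℝ] E)) +
      ((δ' : E →ₗ[ℝ] ℝ).smulRight (A.symm (W (ψ z)))) =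
      (fderiv ℝ V z : E →ₗ[ℝ] E) +
        (((A.symm : E →L[ℝ] E) ∘L H (V z) : E →L[ℝ] E) : E →ₗ[ℝ] E) := by
    ext x
    have h1 := congrArg A.symm (DFunLike.congr_fun heq x)
    simp only [hA, _root_.add_apply, _root_.smul_apply,
      ContinuousLinearMap.comp_apply, ContinuousLinearMap.smulRight_apply,
      ContinuousLinearMap.flip_apply, map_add, map_smul, ContinuousLinearEquiv.coe_coe,
      ContinuousLinearEquiv.symm_apply_apply] at h1
    simp only [LinearMap.add_apply, LinearMap.smul_apply, LinearMap.smulRight_apply,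
      LinearEquiv.conj_apply, LinearMap.comp_apply, ContinuousLinearMap.coe_coe,
      ContinuousLinearMap.comp_apply, ContinuousLinearEquiv.coe_coe]
    rw [hsymm (V z) x]
    exact h1
  have htr := congrArg (LinearMap.trace ℝ E) hlin
  rw [map_add, map_add, map_smul, LinearMap.trace_conj', LinearMap.trace_smulRight] at htr
  have hT : δ' (A.symm (W (ψ z))) = T (V z) := by
    rw [hV', hδ']
    simp only [T, map_smul, ContinuousLinearMap.comp_smul, ContinuousLinearMap.toLinearMap_smul,
      smul_eq_mul]
  have : (δ' : E →ₗ[ℝ] ℝ) (A.symm (W (ψ z))) = T (V z) := hT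
  rw [this] at htr
  simpa [T] using htr

/-- A differentiable function has zero derivative at almost every one of its zeros. -/
theorem ae_fderiv_eq_zero_of_eq_zero [MeasurableSpace E] [BorelSpace E] (μ : Measure E)
    [μ.IsAddHaarMeasure] {T : Set E} (hT : IsOpen T) {φ : E → ℝ}
    (hφ : ∀ z ∈ T, DifferentiableAt ℝ φ z) :
    ∀ᵐ z ∂μ, z ∈ T → φ z = 0 → fderiv ℝ φ z = 0 := by
  set S := {z ∈ T | φ z = 0} with hS
  have hSm : MeasurableSet S := by
    have hc : ContinuousOn φ T := fun z hz ↦ (hφ z hz).continuousAt.continuousWithinAt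
    obtain ⟨u, hu, hu'⟩ := (continuousOn_iff_isClosed.1 hc) {0} isClosed_singleton
    have : S = u ∩ T := by
      rw [← hu']
      ext z
      simp [hS, and_comm]
    rw [this]
    exact hu.measurableSet.inter hT.measurableSet
  by_cases hE : ∀ e : E, e = 0
  · refine Eventually.of_forall fun z _ _ ↦ ?_
    ext v
    rw [hE v]
    simp
  push Not at hE
  obtain ⟨e, he⟩ := hE
  -- On S the function is identically zero, so the zero map approximates it with constant 0; at
  -- almost every point of S the derivative is within that constant of the approximating map. The
  -- factor e only makes it a map from E to itself.
  have hf : ApproximatesLinearOn (fun z ↦ φ z • e) (0 : E →L[ℝ] E) S 0 := by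
    intro x hx y hy
    simp [hx.2, hy.2]
  have := hf.norm_fderiv_sub_le μ hSm (fun z ↦ (fderiv ℝ φ z).smulRight e) fun z hz ↦
    ((hφ z hz.1).hasFDerivAt.smul_const e).hasFDerivWithinAt
  rw [ae_restrict_iff' hSm] at this
  filter_upwards [this] with z hz hzT hz0
  have h := hz ⟨hzT, hz0⟩
  simp only [sub_zero, nonpos_iff_eq_zero, nnnorm_eq_zero] at h
  ext v
  have := DFunLike.congr_fun h v
  simpa [he] using this

omit [FiniteDimensional ℝ E] in
/-- If `G` is differentiable, vanishes where `q` does, and `q ≥ 0` is differentiable, then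
`√q ^ (p - 2) • G` is differentiable for `p ≥ 2`. -/
theorem differentiableAt_sqrt_rpow_smul {F : Type*} [NormedAddCommGroup F] [NormedSpace ℝ F]
    {q : E → ℝ} {G : E → F} {z : E} {p : ℝ} (hp : 2 ≤ p) (hq0 : 0 ≤ q z)
    (hq : DifferentiableAt ℝ q z) (hG : DifferentiableAt ℝ G z) (h0 : q z = 0 → G z = 0) :
    DifferentiableAt ℝ (fun y ↦ Real.sqrt (q y) ^ (p - 2) • G y) z := by
  -- For p = 2 the factor is `0 ^ 0 = 1` at a zero of q and the map is G itself. For p > 2 the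
  -- factor tends to 0 at such a point while G = O(y - z), so the product is o(y - z).
  rcases hp.eq_or_lt with rfl | hp
  · simpa using hG
  rcases hq0.eq_or_lt with hz | hz
  · have hGz := h0 hz.symm
    have : HasFDerivAt (fun y ↦ Real.sqrt (q y) ^ (p - 2) • G y) (0 : E →L[ℝ] F) z := by
      rw [hasFDerivAt_iff_isLittleO]
      simp only [hGz, smul_zero, sub_zero, _root_.zero_apply]
      have h1 : (fun y ↦ Real.sqrt (q y) ^ (p - 2)) =o[𝓝 z] (fun _ ↦ (1 : ℝ)) := by
        rw [Asymptotics.isLittleO_one_iff]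
        have : ContinuousAt (fun y ↦ Real.sqrt (q y) ^ (p - 2)) z :=
          (hq.continuousAt.sqrt).rpow_const (Or.inr (by linarith))
        have h := this.tendsto
        rwa [← hz, Real.sqrt_zero, Real.zero_rpow (by linarith)] at h
      have h2 : G =O[𝓝 z] (fun y ↦ y - z) := by
        simpa [hGz] using hG.hasFDerivAt.isBigO_sub
      simpa using h1.smul_isBigO h2.norm_right
    exact this.differentiableAt
  · exact ((hq.sqrt hz.ne').rpow_const (Or.inl (Real.sqrt_pos.2 hz).ne')).smul hG

end Euclidean

/-! ### The divergence theorem in Euclidean space. -/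

theorem trace_euclideanSpace {n : ℕ} (A : EuclideanSpace ℝ (Fin n) →ₗ[ℝ] EuclideanSpace ℝ (Fin n)) :
    LinearMap.trace ℝ _ A = ∑ i, A (EuclideanSpace.single i (1 : ℝ)) i := by
  rw [LinearMap.trace_eq_sum_inner A (EuclideanSpace.basisFun (Fin n) ℝ)]
  simp [EuclideanSpace.inner_single_left]

/-- The divergence theorem for a compactly supported vector field. -/
theorem integral_trace_fderiv_eq_zero {n : ℕ}
    {F : EuclideanSpace ℝ (Fin n) → EuclideanSpace ℝ (Fin n)}
    (hF : Differentiable ℝ F) (hc : HasCompactSupport F)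
    (hi : Integrable (fun z ↦ LinearMap.trace ℝ _
      (fderiv ℝ F z : EuclideanSpace ℝ (Fin n) →ₗ[ℝ] EuclideanSpace ℝ (Fin n)))) :
    ∫ z, LinearMap.trace ℝ _
      (fderiv ℝ F z : EuclideanSpace ℝ (Fin n) →ₗ[ℝ] EuclideanSpace ℝ (Fin n)) = 0 := by
  simp only [trace_euclideanSpace] at hi ⊢
  cases n with
  | zero => simp
  | succ k =>
  obtain ⟨R, hR, hFR⟩ := hc.exists_pos_le_norm
  let e : (Fin (k + 1) → ℝ) ≃L[ℝ] EuclideanSpace ℝ (Fin (k + 1)) :=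
    (EuclideanSpace.equiv (Fin (k + 1)) ℝ).symm
  have hmp : MeasurePreserving e volume volume := PiLp.volume_preserving_toLp (Fin (k + 1))
  have hme : MeasurableEmbedding e := e.toHomeomorph.measurableEmbedding
  set D : EuclideanSpace ℝ (Fin (k + 1)) → ℝ := fun z ↦
    ∑ i, (fderiv ℝ F z : _ →ₗ[ℝ] EuclideanSpace ℝ (Fin (k + 1)))
      (EuclideanSpace.single i (1 : ℝ)) i with hD
  have hD0 : ∀ z, R < ‖z‖ → D z = 0 := by
    intro z hz
    have : F =ᶠ[𝓝 z] fun _ ↦ 0 := by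
      filter_upwards [continuous_norm.continuousAt.eventually (lt_mem_nhds hz)] with y hy
      exact hFR y hy.le
    have h0 : fderiv ℝ F z = 0 := by rw [this.fderiv_eq]; simp
    simp [hD, h0]
  have hle : ∀ (x : Fin (k + 1) → ℝ) i, |x i| ≤ ‖e x‖ := fun x i ↦
    PiLp.norm_apply_le (e x) i
  let f : Fin (k + 1) → (Fin (k + 1) → ℝ) → ℝ := fun i x ↦ F (e x) i
  let f' : Fin (k + 1) → (Fin (k + 1) → ℝ) → (Fin (k + 1) → ℝ) →L[ℝ] ℝ := fun i x ↦
    (EuclideanSpace.proj i : EuclideanSpace ℝ (Fin (k + 1)) →L[ℝ] ℝ) ∘L (fderiv ℝ F (e x)) ∘L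
      (e : (Fin (k + 1) → ℝ) →L[ℝ] EuclideanSpace ℝ (Fin (k + 1)))
  have hf' : ∀ i x, HasFDerivAt (f i) (f' i x) x := by
    intro i x
    have h1 := (hF (e x)).hasFDerivAt.comp x e.hasFDerivAt
    exact (EuclideanSpace.proj i : EuclideanSpace ℝ (Fin (k + 1)) →L[ℝ] ℝ).hasFDerivAt.comp x h1
  have hsum : ∀ x, ∑ i, f' i x (Pi.single i 1) = D (e x) := by
    intro x
    refine Finset.sum_congr rfl fun i _ ↦ ?_
    rfl
  have hI : Integrable (fun x ↦ ∑ i, f' i x (Pi.single i 1)) := by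
    simp_rw [hsum]
    exact (hmp.integrable_comp_emb hme).2 hi
  -- The box version needs only pointwise differentiability and an integrable divergence, not C¹.
  -- Points on the faces of [-R, R]^(k+1) have Euclidean norm at least R, so F vanishes there.
  have key := integral_divergence_of_hasFDerivAt_off_countable' (fun _ ↦ -R) (fun _ ↦ R)
    (fun _ ↦ by linarith) f f' ∅ countable_empty
    (fun i x _ ↦ (hf' i x).continuousAt.continuousWithinAt) (fun x _ i ↦ hf' i x)
    hI.integrableOn
  have hface : ∀ (i : Fin (k + 1)) (c : ℝ), R ≤ |c| → ∀ x, f i (i.insertNth c x) = 0 := by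
    intro i c hcR x
    have : F (e (i.insertNth c x)) = 0 := by
      refine hFR _ (hcR.trans ?_)
      simpa using hle (i.insertNth c x) i
    simp [f, this]
  rw [← hmp.integral_comp hme]
  have hsum' : (fun x ↦ D (e x)) = fun x ↦ ∑ i, f' i x (Pi.single i 1) := funext fun x ↦ (hsum x).symm
  change ∫ x, D (e x) = 0
  rw [hsum', ← setIntegral_eq_integral_of_forall_compl_eq_zero (s := Icc (fun _ ↦ -R) (fun _ ↦ R)), key]
  · refine Finset.sum_eq_zero fun i _ ↦ ?_
    simp [hface i R (le_abs_self R), hface i (-R) (by rw [abs_neg]; exact le_abs_self R)]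
  · intro x hx
    rw [hsum]
    apply hD0
    by_contra! h
    apply hx
    have := fun i ↦ abs_le.1 ((hle x i).trans h)
    exact ⟨fun i ↦ (this i).1, fun i ↦ (this i).2⟩

/-! ### Monotonicity of the frequency for an abstract evolution equation. -/

section Time

/-- A continuous function that is touched from above, from the left of each point, by a function
with nonnegative derivative is at its end point at least as large as at its starting point. -/
theorem le_of_touching {F : ℝ → ℝ} {α s : ℝ} (hα : α ≤ s) (hF : ContinuousOn F (Icc α s))
    (h : ∀ t ∈ Ioc α s, ∃ (B : ℝ → ℝ) (c : ℝ), B t = F t ∧ 0 ≤ c ∧ HasDerivAt B c t ∧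
      ∀ᶠ τ in 𝓝[<] t, F τ ≤ B τ) : F α ≤ F s := by
  -- Time is reversed so that touching from the left bounds right slopes. The reversed function has
  -- lower right slopes at most 0, hence stays below its initial value `F s`.
  have hg : ContinuousOn (fun τ ↦ F (-τ)) (Icc (-s) (-α)) :=
    hF.comp continuous_neg.continuousOn fun τ hτ ↦ ⟨by linarith [hτ.2], by linarith [hτ.1]⟩
  have key := image_le_of_liminf_slope_right_le_deriv_boundary (B := fun _ ↦ F s)
    (B' := fun _ ↦ 0) hg (by simp) continuousOn_const
    (fun x _ ↦ hasDerivWithinAt_const _ _ _) ?_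
  · simpa using key (x := -α) ⟨by linarith, le_rfl⟩
  intro x hx r hr
  obtain ⟨B, c, hB, hc, hBd, hle⟩ := h (-x) ⟨by linarith [hx.2], by linarith [hx.1]⟩
  have h1 : HasDerivAt (fun τ ↦ B (-τ)) (-c) x :=
    (HasDerivAt.comp x hBd (hasDerivAt_neg x)).congr_deriv (by simp)
  have h2 : ∀ᶠ z in 𝓝[>] x, slope (fun τ ↦ B (-τ)) x z < r := by
    have := (hasDerivAt_iff_tendsto_slope.1 h1).eventually (gt_mem_nhds (show -c < r by linarith))
    exact this.filter_mono (nhdsWithin_mono _ fun z hz ↦ ne_of_gt hz)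
  have h3 : ∀ᶠ z in 𝓝[>] x, F (-z) ≤ B (-z) := by
    have : Tendsto (fun z : ℝ ↦ -z) (𝓝[>] x) (𝓝[<] (-x)) := tendsto_neg_nhdsGT
    exact this.eventually hle
  refine Eventually.frequently ?_
  filter_upwards [h2, h3, self_mem_nhdsWithin] with z hz2 hz3 hz
  refine lt_of_le_of_lt ?_ hz2
  rw [slope_def_field, slope_def_field]
  have : 0 < z - x := sub_pos.2 hz
  rw [hB]
  gcongr

variable {X : Type*} [TopologicalSpace X] [CompactSpace X] [MeasurableSpace X] [BorelSpace X]
  {μ : Measure X} [IsFiniteMeasure μ]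

theorem integrable_of_continuous {g : X → ℝ} (hg : Continuous g) : Integrable g μ :=
  hg.integrable_of_hasCompactSupport (HasCompactSupport.of_compactSpace g)

omit [CompactSpace X] [MeasurableSpace X] [BorelSpace X] in
theorem continuous_slice {V : Type*} [TopologicalSpace V] {a b : ℝ} {H : X → ℝ → V}
    (hH : ContinuousOn (fun q : X × ℝ ↦ H q.1 q.2) (univ ×ˢ Icc a b)) {t : ℝ}
    (ht : t ∈ Icc a b) : Continuous fun x ↦ H x t :=
  hH.comp_continuous (f := fun x : X ↦ (x, t)) (by fun_prop) fun x ↦ ⟨mem_univ x, ht⟩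

theorem continuousOn_integral_slice {a b : ℝ} {H : X → ℝ → ℝ}
    (hH : ContinuousOn (fun q : X × ℝ ↦ H q.1 q.2) (univ ×ˢ Icc a b)) :
    ContinuousOn (fun t ↦ ∫ x, H x t ∂μ) (Icc a b) := by
  refine continuousOn_integral_of_compact_support (f := fun t x ↦ H x t) isCompact_univ ?_
    fun p x _ hx ↦ (hx (mem_univ x)).elim
  exact hH.comp continuous_swap.continuousOn fun q hq ↦ ⟨mem_univ _, hq.1⟩

theorem hasDerivAt_integral_slice {a b : ℝ} {H H' : X → ℝ → ℝ}
    (hH : ContinuousOn (fun q : X × ℝ ↦ H q.1 q.2) (univ ×ˢ Icc a b))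
    (hH' : ContinuousOn (fun q : X × ℝ ↦ H' q.1 q.2) (univ ×ˢ Icc a b))
    (hd : ∀ x, ∀ t ∈ Ioo a b, HasDerivAt (H x) (H' x t) t) {t : ℝ} (ht : t ∈ Ioo a b) :
    HasDerivAt (fun t ↦ ∫ x, H x t ∂μ) (∫ x, H' x t ∂μ) t := by
  obtain ⟨C, hC⟩ := (isCompact_univ.prod isCompact_Icc).exists_bound_of_continuousOn hH'
  refine (hasDerivAt_integral_of_dominated_loc_of_deriv_le (F := fun t x ↦ H x t)
    (F' := fun t x ↦ H' x t) (bound := fun _ ↦ C) (s := Ioo a b)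
    (isOpen_Ioo.mem_nhds ht) ?_ ?_ ?_ ?_ (integrable_const C) ?_).2
  · filter_upwards [isOpen_Ioo.mem_nhds ht] with τ hτ
    exact (continuous_slice hH (Ioo_subset_Icc_self hτ)).aestronglyMeasurable
  · exact integrable_of_continuous (continuous_slice hH (Ioo_subset_Icc_self ht))
  · exact (continuous_slice hH' (Ioo_subset_Icc_self ht)).aestronglyMeasurable
  · exact Eventually.of_forall fun x τ hτ ↦ hC (x, τ) ⟨mem_univ _, Ioo_subset_Icc_self hτ⟩
  · exact Eventually.of_forall fun x τ hτ ↦ hd x τ hτ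

variable {V : Type*} [NormedAddCommGroup V] [InnerProductSpace ℝ V]

/-- For p < 2 the first factor is unbounded near the zeros of `q.1`, but the product is p⁻¹ times
the derivative of the C¹ function ‖·‖^p. This makes |u|^{p-2} ⟨u, u_t⟩ continuous across the zeros
of u. -/
theorem continuous_rpow_mul_inner {p : ℝ} (hp : 1 < p) :
    Continuous fun q : V × V ↦ ‖q.1‖ ^ (p - 2) * inner ℝ q.1 q.2 := by
  have h1 : Continuous fun q : V × V ↦ fderiv ℝ (fun v : V ↦ ‖v‖ ^ p) q.1 q.2 :=
    (((contDiff_norm_rpow hp).continuous_fderiv (by simp)).comp continuous_fst).clm_apply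
      continuous_snd
  have h2 : (fun q : V × V ↦ ‖q.1‖ ^ (p - 2) * inner ℝ q.1 q.2) =
      fun q ↦ p⁻¹ * fderiv ℝ (fun v : V ↦ ‖v‖ ^ p) q.1 q.2 := by
    funext q
    rw [fderiv_norm_rpow _ hp]
    have : p ≠ 0 := by linarith
    simp only [_root_.smul_apply, innerSL_apply_apply, smul_eq_mul]
    field_simp
  rw [h2]
  exact continuous_const.mul h1

omit [InnerProductSpace ℝ V] in
theorem rpow_sub_two_mul_sq {p : ℝ} (hp : 1 < p) (v : V) : ‖v‖ ^ (p - 2) * ‖v‖ ^ 2 = ‖v‖ ^ p := by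
  rcases eq_or_ne v 0 with rfl | hv
  · rw [norm_zero, Real.zero_rpow (by linarith : p ≠ 0)]
    simp
  · rw [← Real.rpow_natCast, ← Real.rpow_add (norm_pos_iff.2 hv)]
    norm_num

/-- The lower growth bound for `∫ |u| ^ p`, for an abstract doubly nonlinear evolution equation
`|u| ^ (p - 2) u' - L = η |u| ^ (p - 2) u` in which `L` satisfies a convexity inequality. -/
theorem growth_of_evolution {a b p : ℝ} (hab : a < b) (hp : 1 < p) {η : ℝ → ℝ}
    (hη : ContinuousOn η (Icc a b)) {u u' : X → ℝ → V} {L : ℝ → X → V}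
    (hu : ContinuousOn (fun q : X × ℝ ↦ u q.1 q.2) (univ ×ˢ Icc a b))
    (hu' : ContinuousOn (fun q : X × ℝ ↦ u' q.1 q.2) (univ ×ˢ Icc a b))
    (hd : ∀ x, ∀ t ∈ Ioo a b, HasDerivAt (u x) (u' x t) t)
    (hL : ∀ t ∈ Icc a b, Continuous (L t))
    (heq : ∀ t ∈ Icc a b, ∀ x, (2 ≤ p ∨ u x t ≠ 0) →
      ‖u x t‖ ^ (p - 2) • u' x t - L t x = (η t * ‖u x t‖ ^ (p - 2)) • u x t)
    (hae : p < 2 → ∀ t ∈ Icc a b, ∀ᵐ x ∂μ, u x t = 0 → L t x = 0)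
    (hconv : ∀ s ∈ Icc a b, ∀ t ∈ Icc a b, ∫ x, inner ℝ (u x t) (L t x) ∂μ ≤
      ∫ x, inner ℝ (u x s) (L s x) ∂μ + p * ∫ x, inner ℝ (L s x) (u x t - u x s) ∂μ) :
    (∫ x, ‖u x a‖ ^ p ∂μ) * Real.exp (p * (∫ t in a..b, η t) +
      p * ((∫ x, inner ℝ (u x a) (L a x) ∂μ) / ∫ x, ‖u x a‖ ^ p ∂μ) * (b - a)) ≤
      ∫ x, ‖u x b‖ ^ p ∂μ := by
  set I : ℝ → ℝ := fun t ↦ ∫ x, ‖u x t‖ ^ p ∂μ with hI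
  set D : ℝ → ℝ := fun t ↦ ∫ x, inner ℝ (u x t) (L t x) ∂μ with hD
  change I a * Real.exp (p * (∫ t in a..b, η t) + p * (D a / I a) * (b - a)) ≤ I b
  have hp0 : 0 < p := by linarith
  have hInn : ∀ t, 0 ≤ I t := fun t ↦
    integral_nonneg fun x ↦ Real.rpow_nonneg (norm_nonneg _) _
  -- regularity of the integrands
  have hN : ContinuousOn (fun q : X × ℝ ↦ ‖u q.1 q.2‖ ^ p) (univ ×ˢ Icc a b) :=
    hu.norm.rpow_const fun _ _ ↦ Or.inr hp0.le
  have hΦ : ContinuousOn (fun q : X × ℝ ↦ ‖u q.1 q.2‖ ^ (p - 2) * inner ℝ (u q.1 q.2) (u' q.1 q.2))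
      (univ ×ˢ Icc a b) :=
    (continuous_rpow_mul_inner hp).comp_continuousOn (hu.prodMk hu')
  have hNd : ∀ x, ∀ t ∈ Ioo a b, HasDerivAt (fun t ↦ ‖u x t‖ ^ p)
      (p * (‖u x t‖ ^ (p - 2) * inner ℝ (u x t) (u' x t))) t := by
    intro x t ht
    have := (hasFDerivAt_norm_rpow (u x t) hp).comp_hasDerivAt t (hd x t ht)
    refine this.congr_deriv ?_
    simp only [_root_.smul_apply, innerSL_apply_apply, smul_eq_mul]
    ring
  have hIc : ContinuousOn I (Icc a b) := continuousOn_integral_slice hN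
  -- After pairing with u, both sides vanish at the zeros of u, so the identity holds also where the
  -- equation is not imposed.
  have hpt : ∀ t ∈ Icc a b, ∀ x, inner ℝ (u x t) (L t x) =
      ‖u x t‖ ^ (p - 2) * inner ℝ (u x t) (u' x t) - η t * ‖u x t‖ ^ p := by
    intro t ht x
    by_cases h0 : u x t = 0
    · simp [h0, Real.zero_rpow hp0.ne']
    · have h1 : L t x = ‖u x t‖ ^ (p - 2) • u' x t - (η t * ‖u x t‖ ^ (p - 2)) • u x t := by
        rw [← heq t ht x (Or.inr h0)]
        abel
      rw [h1, inner_sub_right, real_inner_smul_right, real_inner_smul_right,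
        real_inner_self_eq_norm_sq, mul_assoc, rpow_sub_two_mul_sq hp]
  have hDeq : ∀ t ∈ Icc a b, D t =
      (∫ x, ‖u x t‖ ^ (p - 2) * inner ℝ (u x t) (u' x t) ∂μ) - η t * I t := by
    intro t ht
    rw [hD, hI]
    simp only
    rw [integral_congr_ae (Eventually.of_forall (hpt t ht)), integral_sub
      (integrable_of_continuous (continuous_slice (H := fun x t ↦ ‖u x t‖ ^ (p - 2) *
        inner ℝ (u x t) (u' x t)) hΦ ht))
      ((integrable_of_continuous (continuous_slice (H := fun x t ↦ ‖u x t‖ ^ p) hN ht)).const_mul _),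
      integral_const_mul]
  -- L is not assumed continuous in time; continuity of D comes from the formula that replaces L by
  -- u'.
  have hDc : ContinuousOn D (Icc a b) := by
    refine ContinuousOn.congr ?_ hDeq
    exact (continuousOn_integral_slice (H := fun x t ↦ ‖u x t‖ ^ (p - 2) *
        inner ℝ (u x t) (u' x t)) hΦ).sub (hη.mul hIc)
  have hId : ∀ t ∈ Ioo a b, HasDerivAt I (p * (D t + η t * I t)) t := by
    intro t ht
    have h1 := hasDerivAt_integral_slice (μ := μ) (H := fun x t ↦ ‖u x t‖ ^ p)
      (H' := fun x t ↦ p * (‖u x t‖ ^ (p - 2) * inner ℝ (u x t) (u' x t))) hN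
      (continuousOn_const.mul hΦ) hNd ht
    refine h1.congr_deriv ?_
    rw [integral_const_mul, hDeq t (Ioo_subset_Icc_self ht), sub_add_cancel]
  -- the frequency is touched from above by a function with nonnegative derivative
  have htouch : ∀ s ∈ Ioo a b, 0 < I s → ∃ (B : ℝ → ℝ) (c : ℝ), B s = D s / I s ∧ 0 ≤ c ∧
      HasDerivAt B c s ∧ ∀ᶠ τ in 𝓝[<] s, D τ / I τ ≤ B τ := by
    intro s hs hIs
    have hs' := Ioo_subset_Icc_self hs
    set J : ℝ := ∫ x, inner ℝ (L s x) (u' x s) ∂μ with hJ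
    have hcL : ∀ {w : X → ℝ → V}, ContinuousOn (fun q : X × ℝ ↦ w q.1 q.2) (univ ×ˢ Icc a b) →
        ContinuousOn (fun q : X × ℝ ↦ inner ℝ (L s q.1) (w q.1 q.2)) (univ ×ˢ Icc a b) :=
      fun hw ↦ ((hL s hs').comp continuous_fst).continuousOn.inner hw
    have hsub : ContinuousOn (fun q : X × ℝ ↦ u q.1 q.2 - u q.1 s) (univ ×ˢ Icc a b) :=
      hu.sub ((continuous_slice hu hs').comp continuous_fst).continuousOn
    -- R is the right side of `hconv` at s: it majorizes D, agrees with D at s, and depends on t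
    -- only through an expression affine in u, so it is differentiable without any knowledge of D'.
    set R : ℝ → ℝ := fun t ↦ D s + p * ∫ x, inner ℝ (L s x) (u x t - u x s) ∂μ with hR
    have hRd : HasDerivAt R (p * J) s := by
      refine ((hasDerivAt_integral_slice (H := fun x t ↦ inner ℝ (L s x) (u x t - u x s))
        (H' := fun x t ↦ inner ℝ (L s x) (u' x t)) (hcL (w := fun x t ↦ u x t - u x s) hsub)
        (hcL hu') ?_ hs).const_mul p).const_add (D s)
      intro x t ht
      exact (innerSL ℝ (L s x)).hasFDerivAt.comp_hasDerivAt t ((hd x t ht).sub_const (u x s))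
    have hRs : R s = D s := by simp [hR]
    refine ⟨fun t ↦ R t / I t, _, by simp only [hRs], ?_, hRd.div (hId s hs) hIs.ne', ?_⟩
    · -- the Cauchy--Schwarz inequality
      refine div_nonneg ?_ (sq_nonneg _)
      rw [hRs]
      have i1 : Integrable (fun x ↦ inner ℝ (L s x) (u' x s)) μ :=
        integrable_of_continuous (continuous_slice (H := fun x t ↦ inner ℝ (L s x) (u' x t))
          (hcL hu') hs')
      have i2 : Integrable (fun x ↦ inner ℝ (L s x) (u x s)) μ :=
        integrable_of_continuous (continuous_slice (H := fun x t ↦ inner ℝ (L s x) (u x t))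
          (hcL hu) hs')
      have i3 : Integrable (fun x ↦ ‖u x s‖ ^ p) μ :=
        integrable_of_continuous (continuous_slice (H := fun x t ↦ ‖u x t‖ ^ p) hN hs')
      -- The expression is ∫ ‖u‖^(p-2) ‖w + r u‖² with w = u' - ηu. Expanding it through L =
      -- ‖u‖^(p-2) w leaves only integrals of continuous functions, even for p < 2. Where the
      -- equation is missing, L = u = 0 almost everywhere and the integrand is 0.
      have hquad : ∀ r : ℝ, 0 ≤ J + (2 * r - η s) * D s + r ^ 2 * I s := by
        intro r
        have e1 : J + (2 * r - η s) * D s + r ^ 2 * I s =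
            ∫ x, (inner ℝ (L s x) (u' x s) + (2 * r - η s) * inner ℝ (L s x) (u x s) +
              r ^ 2 * ‖u x s‖ ^ p) ∂μ := by
          have i4 : Integrable (fun x ↦ inner ℝ (L s x) (u' x s) +
              (2 * r - η s) * inner ℝ (L s x) (u x s)) μ := i1.add (i2.const_mul _)
          rw [integral_add i4 (i3.const_mul _),
            integral_add i1 (i2.const_mul _), integral_const_mul, integral_const_mul]
          simp only [hJ, hD, hI, real_inner_comm]
        rw [e1]
        refine integral_nonneg_of_ae ?_
        have hae' : ∀ᵐ x ∂μ, L s x = 0 ∧ u x s = 0 ∨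
            L s x = ‖u x s‖ ^ (p - 2) • (u' x s - η s • u x s) := by
          have hgen : ∀ x, (2 ≤ p ∨ u x s ≠ 0) →
              L s x = ‖u x s‖ ^ (p - 2) • (u' x s - η s • u x s) := by
            intro x hx
            have := heq s hs' x hx
            rw [smul_sub, smul_smul, mul_comm _ (η s), ← this]
            abel
          rcases le_or_gt 2 p with h2 | h2
          · exact Eventually.of_forall fun x ↦ Or.inr (hgen x (Or.inl h2))
          · filter_upwards [hae h2 s hs'] with x hx
            by_cases h0 : u x s = 0
            · exact Or.inl ⟨hx h0, h0⟩
            · exact Or.inr (hgen x (Or.inr h0))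
        filter_upwards [hae'] with x hx
        simp only [Pi.zero_apply]
        rcases hx with ⟨h1, h2⟩ | h1
        · simp [h1, h2, Real.zero_rpow hp0.ne']
        · set w := u' x s - η s • u x s with hw
          have hw' : u' x s = w + η s • u x s := by rw [hw]; abel
          have e2 : inner ℝ (L s x) (u' x s) + (2 * r - η s) * inner ℝ (L s x) (u x s) +
              r ^ 2 * ‖u x s‖ ^ p = ‖u x s‖ ^ (p - 2) * ‖w + r • u x s‖ ^ 2 := by
            rw [norm_add_sq_real, h1, hw', ← rpow_sub_two_mul_sq hp]
            simp only [inner_add_right, real_inner_smul_left, real_inner_smul_right,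
              real_inner_self_eq_norm_sq, norm_smul, mul_pow, Real.norm_eq_abs, sq_abs]
            ring
          rw [e2]
          positivity
      -- This r minimizes the quadratic. Multiplying by I gives J I ≥ D (D + ηI), which is, up to
      -- the factor p, the sign of the numerator of (R/I)'.
      have h1 := hquad (-(D s / I s))
      have h4 : 0 ≤ I s * (J + (2 * -(D s / I s) - η s) * D s + (-(D s / I s)) ^ 2 * I s) :=
        mul_nonneg hIs.le h1
      have h5 : I s * (J + (2 * -(D s / I s) - η s) * D s + (-(D s / I s)) ^ 2 * I s) =
          J * I s - D s * (D s + η s * I s) := by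
        field_simp
        ring
      rw [h5] at h4
      calc (0 : ℝ) ≤ p * (J * I s - D s * (D s + η s * I s)) := mul_nonneg hp0.le h4
        _ = p * J * I s - D s * (p * (D s + η s * I s)) := by ring
    · have hev : ∀ᶠ τ in 𝓝 s, τ ∈ Ioo a b := isOpen_Ioo.mem_nhds hs
      filter_upwards [hev.filter_mono nhdsWithin_le_nhds] with τ hτ
      exact div_le_div_of_nonneg_right (hconv s hs' τ (Ioo_subset_Icc_self hτ)) (hInn τ)
  -- the modified integral is nondecreasing as long as it is positive
  set E : ℝ → ℝ := fun t ↦ Real.exp (-(p * (∫ τ in a..t, η τ) + p * (D a / I a) * (t - a)))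
    with hE
  have hηi : ∀ t ∈ Icc a b, HasDerivWithinAt (fun t ↦ ∫ τ in a..t, η τ) (η t) (Icc a b) t := by
    intro t ht
    have : Fact (t ∈ Icc a b) := ⟨ht⟩
    refine intervalIntegral.integral_hasDerivWithinAt_right ?_ ?_ (hη t ht)
    · exact (hη.mono (Icc_subset_Icc_right ht.2)).intervalIntegrable_of_Icc ht.1
    · exact hη.stronglyMeasurableAtFilter_nhdsWithin measurableSet_Icc t
  have hEc : ContinuousOn E (Icc a b) := by
    have : ContinuousOn (fun t ↦ ∫ τ in a..t, η τ) (Icc a b) :=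
      fun t ht ↦ (hηi t ht).continuousWithinAt
    exact Real.continuous_exp.comp_continuousOn ((continuousOn_const.mul this).add
      (continuousOn_const.mul (continuousOn_id.sub continuousOn_const))).neg
  have hEa : E a = 1 := by simp [hE]
  -- Positivity is required only before c, so the estimate can be applied at a first zero of I as
  -- well as at b.
  have hgrow : ∀ c ∈ Ioc a b, (∀ t ∈ Ico a c, 0 < I t) → I a ≤ I c * E c := by
    intro c hc hpos
    have hsub : Icc a c ⊆ Icc a b := Icc_subset_Icc_right hc.2
    have hmono : MonotoneOn (fun t ↦ I t * E t) (Icc a c) := by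
      refine monotoneOn_of_deriv_nonneg (convex_Icc a c) ((hIc.mul hEc).mono hsub) ?_ ?_
      all_goals
        rw [interior_Icc]
        intro t ht
        have htb : t ∈ Ioo a b := ⟨ht.1, ht.2.trans_le hc.2⟩
        have h1 : HasDerivAt (fun t ↦ ∫ τ in a..t, η τ) (η t) t :=
          (hηi t (Ioo_subset_Icc_self htb)).hasDerivAt (Icc_mem_nhds htb.1 htb.2)
        have h2 : HasDerivAt E (E t * -(p * η t + p * (D a / I a))) t := by
          have h3 := ((h1.const_mul p).add
            (((hasDerivAt_id t).sub_const a).const_mul (p * (D a / I a)))).neg.exp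
          simpa [hE] using h3
        have h3 := (hId t htb).mul h2
      · exact h3.differentiableAt.differentiableWithinAt
      · rw [show (fun t ↦ I t * E t) = I * E from rfl, h3.deriv]
        have hIt := hpos t ⟨ht.1.le, ht.2⟩
        have hmon : D a / I a ≤ D t / I t := by
          refine le_of_touching (F := fun t ↦ D t / I t) ht.1.le ?_ ?_
          · refine ContinuousOn.div (hDc.mono ?_) (hIc.mono ?_) ?_
            · exact Icc_subset_Icc_right htb.2.le
            · exact Icc_subset_Icc_right htb.2.le
            · exact fun s hs ↦ (hpos s ⟨hs.1, hs.2.trans_lt ht.2⟩).ne'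
          · exact fun s hs ↦ htouch s ⟨hs.1, hs.2.trans_lt htb.2⟩
              (hpos s ⟨hs.1.le, hs.2.trans_lt ht.2⟩)
        rw [le_div_iff₀ hIt] at hmon
        have hEt : 0 < E t := Real.exp_pos _
        have : p * (D t + η t * I t) * E t + I t * (E t * -(p * η t + p * (D a / I a))) =
            p * E t * (D t - D a / I a * I t) := by ring
        rw [this]
        exact mul_nonneg (by positivity) (by linarith)
    have := hmono (left_mem_Icc.2 hc.1.le) (right_mem_Icc.2 hc.1.le) hc.1.le
    simpa [hEa] using this
  rcases (hInn a).eq_or_lt with h0 | hIa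
  · rw [← h0, zero_mul]
    exact hInn b
  have hpos : ∀ t ∈ Icc a b, 0 < I t := by
    by_contra! hcon
    obtain ⟨t₀, ht₀, hIt₀⟩ := hcon
    -- At the least zero c the estimate reads I(a) ≤ I(c) E(c) = 0, a contradiction.
    set Z := {t ∈ Icc a b | I t = 0} with hZ
    have hZne : Z.Nonempty := ⟨t₀, ht₀, le_antisymm hIt₀ (hInn t₀)⟩
    have hZc : IsCompact Z := by
      have : IsClosed Z := by
        have h1 := hIc.preimage_isClosed_of_isClosed isClosed_Icc (isClosed_singleton (x := (0 : ℝ)))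
        exact h1
      exact isCompact_Icc.of_isClosed_subset this fun t ht ↦ ht.1
    obtain ⟨c, hcZ, hcmin⟩ := hZc.exists_isLeast hZne
    have hac : a < c := by
      refine lt_of_le_of_ne hcZ.1.1 ?_
      rintro rfl
      exact hIa.ne' hcZ.2
    have h1 := hgrow c ⟨hac, hcZ.1.2⟩ fun t ht ↦ by
      refine lt_of_le_of_ne (hInn t) fun h ↦ ?_
      exact not_le.2 ht.2 (hcmin ⟨⟨ht.1, ht.2.le.trans hcZ.1.2⟩, h.symm⟩)
    rw [hcZ.2, zero_mul] at h1
    linarith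
  have hfin := hgrow b ⟨hab, le_rfl⟩ fun t ht ↦ hpos t ⟨ht.1, ht.2.le⟩
  rw [hE] at hfin
  simp only [Real.exp_neg] at hfin
  rwa [← div_eq_mul_inv, le_div_iff₀ (Real.exp_pos _)] at hfin

end Time

/-! ### Transition maps and the metric in charts. -/

section Charts

variable {n : ℕ} {M : Type*} [TopologicalSpace M] [ChartedSpace (EuclideanSpace ℝ (Fin n)) M]

/-- The transition map from the chart at `x₁` to the chart at `x₀`. -/
def transition (x₁ x₀ : M) (z : EuclideanSpace ℝ (Fin n)) : EuclideanSpace ℝ (Fin n) :=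
  extChartAt (𝓡 n) x₀ ((extChartAt (𝓡 n) x₁).symm z)

/-- The part of the target of the chart at `x₁` that corresponds to points in the domain of the
chart at `x₀`. -/
def overlap (x₁ x₀ : M) : Set (EuclideanSpace ℝ (Fin n)) :=
  (extChartAt (𝓡 n) x₁).target ∩ (extChartAt (𝓡 n) x₁).symm ⁻¹' (extChartAt (𝓡 n) x₀).source

theorem isOpen_overlap (x₁ x₀ : M) : IsOpen (overlap (n := n) x₁ x₀) :=
  (continuousOn_extChartAt_symm x₁).isOpen_inter_preimage (isOpen_extChartAt_target x₁)
    (isOpen_extChartAt_source x₀)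

theorem transition_mem_overlap {x₁ x₀ : M} {z : EuclideanSpace ℝ (Fin n)}
    (hz : z ∈ overlap x₁ x₀) : transition x₁ x₀ z ∈ overlap x₀ x₁ := by
  refine ⟨(extChartAt (𝓡 n) x₀).map_source hz.2, ?_⟩
  rw [mem_preimage, transition, (extChartAt (𝓡 n) x₀).left_inv hz.2]
  exact (extChartAt (𝓡 n) x₁).map_target hz.1

theorem symm_transition {x₁ x₀ : M} {z : EuclideanSpace ℝ (Fin n)} (hz : z ∈ overlap x₁ x₀) :
    (extChartAt (𝓡 n) x₀).symm (transition x₁ x₀ z) = (extChartAt (𝓡 n) x₁).symm z :=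
  (extChartAt (𝓡 n) x₀).left_inv hz.2

theorem transition_transition {x₁ x₀ : M} {z : EuclideanSpace ℝ (Fin n)}
    (hz : z ∈ overlap x₁ x₀) : transition x₀ x₁ (transition x₁ x₀ z) = z := by
  rw [transition, symm_transition hz, (extChartAt (𝓡 n) x₁).right_inv hz.1]

variable [IsManifold (𝓡 n) ∞ M]

theorem contDiffOn_transition (x₁ x₀ : M) :
    ContDiffOn ℝ ∞ (transition x₁ x₀) (overlap (n := n) x₁ x₀) := by
  rw [← contMDiffOn_iff_contDiffOn]
  refine (contMDiffOn_extChartAt (I := 𝓡 n) (n := ∞) (x := x₀)).comp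
    ((contMDiffOn_extChartAt_symm (I := 𝓡 n) (n := ∞) x₁).mono inter_subset_left) ?_
  intro z hz
  simpa using hz.2

theorem contDiffAt_transition {x₁ x₀ : M} {z : EuclideanSpace ℝ (Fin n)}
    (hz : z ∈ overlap x₁ x₀) : ContDiffAt ℝ ∞ (transition x₁ x₀) z :=
  (contDiffOn_transition x₁ x₀).contDiffAt ((isOpen_overlap x₁ x₀).mem_nhds hz)

theorem fderiv_transition_comp {x₁ x₀ : M} {z : EuclideanSpace ℝ (Fin n)}
    (hz : z ∈ overlap x₁ x₀) :
    fderiv ℝ (transition x₀ x₁) (transition x₁ x₀ z) ∘L fderiv ℝ (transition x₁ x₀) z =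
      ContinuousLinearMap.id ℝ (EuclideanSpace ℝ (Fin n)) := by
  have h1 := ((contDiffAt_transition (transition_mem_overlap hz)).differentiableAt
    (by simp)).hasFDerivAt.comp z ((contDiffAt_transition hz).differentiableAt (by simp)).hasFDerivAt
  refine h1.unique ((hasFDerivAt_id z).congr_of_eventuallyEq ?_)
  filter_upwards [(isOpen_overlap x₁ x₀).mem_nhds hz] with y hy
  exact transition_transition hy

/-- The derivative of a transition map. -/
def transitionEquiv {x₁ x₀ : M} {z : EuclideanSpace ℝ (Fin n)} (hz : z ∈ overlap x₁ x₀) :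
    EuclideanSpace ℝ (Fin n) ≃L[ℝ] EuclideanSpace ℝ (Fin n) :=
  ContinuousLinearEquiv.equivOfInverse (fderiv ℝ (transition x₁ x₀) z)
    (fderiv ℝ (transition x₀ x₁) (transition x₁ x₀ z))
    (fun v ↦ DFunLike.congr_fun (fderiv_transition_comp hz) v)
    (fun v ↦ by
      have := fderiv_transition_comp (transition_mem_overlap hz)
      rw [transition_transition hz] at this
      exact DFunLike.congr_fun this v)

theorem coe_transitionEquiv {x₁ x₀ : M} {z : EuclideanSpace ℝ (Fin n)} (hz : z ∈ overlap x₁ x₀) :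
    (transitionEquiv hz : EuclideanSpace ℝ (Fin n) →L[ℝ] EuclideanSpace ℝ (Fin n)) =
      fderiv ℝ (transition x₁ x₀) z := rfl

/-- The derivative at `z` of the inverse of the chart at `x₀`. -/
def frame (x₀ : M) (z : EuclideanSpace ℝ (Fin n)) :
    EuclideanSpace ℝ (Fin n) →L[ℝ] EuclideanSpace ℝ (Fin n) :=
  mfderiv 𝓘(ℝ, EuclideanSpace ℝ (Fin n)) (𝓡 n) (extChartAt (𝓡 n) x₀).symm z

/-- The derivative of the chart at `x₀`, at the point with coordinates `z`. -/
def coframe (x₀ : M) (z : EuclideanSpace ℝ (Fin n)) :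
    EuclideanSpace ℝ (Fin n) →L[ℝ] EuclideanSpace ℝ (Fin n) :=
  mfderiv (𝓡 n) 𝓘(ℝ, EuclideanSpace ℝ (Fin n)) (extChartAt (𝓡 n) x₀)
    ((extChartAt (𝓡 n) x₀).symm z)

theorem mdifferentiableAt_symm {x₀ : M} {z : EuclideanSpace ℝ (Fin n)}
    (hz : z ∈ (extChartAt (𝓡 n) x₀).target) :
    MDifferentiableAt 𝓘(ℝ, EuclideanSpace ℝ (Fin n)) (𝓡 n) (extChartAt (𝓡 n) x₀).symm z :=
  ((contMDiffOn_extChartAt_symm (I := 𝓡 n) (n := ∞) x₀).contMDiffAt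
    ((isOpen_extChartAt_target x₀).mem_nhds hz)).mdifferentiableAt (by simp)

theorem coframe_frame {x₀ : M} {z : EuclideanSpace ℝ (Fin n)}
    (hz : z ∈ (extChartAt (𝓡 n) x₀).target) (v : EuclideanSpace ℝ (Fin n)) :
    coframe x₀ z (frame x₀ z v) = v := by
  have : IsManifold (𝓡 n) 1 M := IsManifold.of_le (n := ∞) (by simp)
  have := mfderiv_extChartAt_comp_mfderivWithin_extChartAt_symm (I := 𝓡 n) hz
  rw [ModelWithCorners.Boundaryless.range_eq_univ, mfderivWithin_univ] at this
  exact DFunLike.congr_fun this v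

theorem frame_coframe {x₀ : M} {z : EuclideanSpace ℝ (Fin n)}
    (hz : z ∈ (extChartAt (𝓡 n) x₀).target) (v : EuclideanSpace ℝ (Fin n)) :
    frame x₀ z (coframe x₀ z v) = v := by
  have : IsManifold (𝓡 n) 1 M := IsManifold.of_le (n := ∞) (by simp)
  have := mfderivWithin_extChartAt_symm_comp_mfderiv_extChartAt (I := 𝓡 n) hz
  rw [ModelWithCorners.Boundaryless.range_eq_univ, mfderivWithin_univ] at this
  exact DFunLike.congr_fun this v

theorem frame_transition {x₁ x₀ : M} {z : EuclideanSpace ℝ (Fin n)} (hz : z ∈ overlap x₁ x₀)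
    (v : EuclideanSpace ℝ (Fin n)) :
    frame x₀ (transition x₁ x₀ z) (fderiv ℝ (transition x₁ x₀) z v) = frame x₁ z v := by
  have h0 : HasMFDerivAt 𝓘(ℝ, EuclideanSpace ℝ (Fin n)) (𝓡 n) (extChartAt (𝓡 n) x₀).symm
      (transition x₁ x₀ z) (frame x₀ (transition x₁ x₀ z)) :=
    (mdifferentiableAt_symm (transition_mem_overlap hz).1).hasMFDerivAt
  have h1 : HasMFDerivAt 𝓘(ℝ, EuclideanSpace ℝ (Fin n)) 𝓘(ℝ, EuclideanSpace ℝ (Fin n))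
      (transition x₁ x₀) z (fderiv ℝ (transition x₁ x₀) z) :=
    ((contDiffAt_transition hz).differentiableAt (by simp)).hasFDerivAt.hasMFDerivAt
  have h2 := h0.comp z h1
  have h3 : HasMFDerivAt 𝓘(ℝ, EuclideanSpace ℝ (Fin n)) (𝓡 n) (extChartAt (𝓡 n) x₁).symm z
      (frame x₁ z) := (mdifferentiableAt_symm hz.1).hasMFDerivAt
  have h4 : (extChartAt (𝓡 n) x₁).symm =ᶠ[𝓝 z]
      (extChartAt (𝓡 n) x₀).symm ∘ transition x₁ x₀ := by
    filter_upwards [(isOpen_overlap x₁ x₀).mem_nhds hz] with y hy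
    exact (symm_transition hy).symm
  have h5 := hasMFDerivAt_unique h3 (h2.congr_of_eventuallyEq h4)
  exact (DFunLike.congr_fun h5 v).symm

/-- Both sides are the components of one tangent vector: carried to M by the two frames they agree
by `frame_transition`, and the coframe at x₀ reads the components off again. -/
theorem fderiv_transition_coordComp (Y : ∀ x : M, TangentSpace (𝓡 n) x) {x₁ x₀ : M}
    {z : EuclideanSpace ℝ (Fin n)} (hz : z ∈ overlap x₁ x₀) :
    fderiv ℝ (transition x₁ x₀) z (coordComp Y x₁ z) = coordComp Y x₀ (transition x₁ x₀ z) := by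
  have h := frame_transition hz (coordComp Y x₁ z)
  have h1 : frame x₁ z (coordComp Y x₁ z) = Y ((extChartAt (𝓡 n) x₁).symm z) :=
    frame_coframe hz.1 _
  rw [h1] at h
  have h2 := congrArg (coframe x₀ (transition x₁ x₀ z)) h
  rw [coframe_frame (transition_mem_overlap hz).1] at h2
  rw [h2]
  have : ∀ x y : M, x = y → (Y x : EuclideanSpace ℝ (Fin n)) = Y y := by
    rintro x _ rfl
    rfl
  unfold coordComp coframe
  exact congrArg _ (this _ _ (symm_transition hz).symm)

/-- The section is the tangent map of the inverse chart applied to a constant field; it gives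
smoothness of the metric coefficients. -/
theorem contMDiffOn_frame (x₀ : M) (v : EuclideanSpace ℝ (Fin n)) :
    ContMDiffOn 𝓘(ℝ, EuclideanSpace ℝ (Fin n)) (𝓡 n).tangent ∞
      (fun z ↦ (⟨(extChartAt (𝓡 n) x₀).symm z, frame x₀ z v⟩ : TangentBundle (𝓡 n) M))
      (extChartAt (𝓡 n) x₀).target := by
  have hs := contMDiffOn_extChartAt_symm (I := 𝓡 n) (n := ∞) x₀
  have ht := hs.contMDiffOn_tangentMapWithin (m := ∞) (by simp)
    (isOpen_extChartAt_target x₀).uniqueMDiffOn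
  have hc : ContMDiffOn 𝓘(ℝ, EuclideanSpace ℝ (Fin n))
      (𝓘(ℝ, EuclideanSpace ℝ (Fin n))).tangent ∞
      (fun z ↦ (⟨z, v⟩ : TangentBundle 𝓘(ℝ, EuclideanSpace ℝ (Fin n)) (EuclideanSpace ℝ (Fin n))))
      (extChartAt (𝓡 n) x₀).target := by
    intro z hz
    refine ContMDiffAt.contMDiffWithinAt ?_
    refine (Bundle.contMDiffAt_section (F := EuclideanSpace ℝ (Fin n))
      (E := fun y : EuclideanSpace ℝ (Fin n) ↦ TangentSpace 𝓘(ℝ, EuclideanSpace ℝ (Fin n)) y)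
      (s := fun _ ↦ v) z).2 ?_
    simpa using contMDiffAt_const
  refine (ht.comp hc fun z hz ↦ hz).congr fun z hz ↦ ?_
  simp only [Function.comp_apply, tangentMapWithin]
  rw [mfderivWithin_of_isOpen (isOpen_extChartAt_target x₀) hz]
  rfl

variable [RiemannianBundle (fun x : M ↦ TangentSpace (𝓡 n) x)]

/-- The metric as a function of two vectors of the model space. -/
def metric (x : M) (v w : EuclideanSpace ℝ (Fin n)) : ℝ :=
  @inner ℝ (TangentSpace (𝓡 n) x) _ v w

omit [IsManifold (𝓡 n) ∞ M] in
theorem metric_sum_left {ι : Type*} (x : M) (s : Finset ι) (f : ι → EuclideanSpace ℝ (Fin n))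
    (w : EuclideanSpace ℝ (Fin n)) : metric x (∑ i ∈ s, f i) w = ∑ i ∈ s, metric x (f i) w :=
  sum_inner (𝕜 := ℝ) (E := TangentSpace (𝓡 n) x) s f w

omit [IsManifold (𝓡 n) ∞ M] in
theorem metric_sum_right {ι : Type*} (x : M) (s : Finset ι) (f : ι → EuclideanSpace ℝ (Fin n))
    (w : EuclideanSpace ℝ (Fin n)) : metric x w (∑ i ∈ s, f i) = ∑ i ∈ s, metric x w (f i) :=
  inner_sum (𝕜 := ℝ) (E := TangentSpace (𝓡 n) x) s f w

omit [IsManifold (𝓡 n) ∞ M] in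
theorem metric_smul_left (x : M) (c : ℝ) (v w : EuclideanSpace ℝ (Fin n)) :
    metric x (c • v) w = c * metric x v w :=
  real_inner_smul_left (F := TangentSpace (𝓡 n) x) v w c

omit [IsManifold (𝓡 n) ∞ M] in
theorem metric_smul_right (x : M) (c : ℝ) (v w : EuclideanSpace ℝ (Fin n)) :
    metric x v (c • w) = c * metric x v w :=
  real_inner_smul_right (F := TangentSpace (𝓡 n) x) v w c

omit [IsManifold (𝓡 n) ∞ M] in
theorem gram_apply (x₀ : M) (z : EuclideanSpace ℝ (Fin n)) (i j : Fin n) :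
    gram x₀ z i j = metric ((extChartAt (𝓡 n) x₀).symm z)
      (frame x₀ z (EuclideanSpace.single i 1)) (frame x₀ z (EuclideanSpace.single j 1)) := rfl

/-- The coordinate vectors are independent because the coframe is a left inverse of the frame, and
the Gram matrix of independent vectors is positive definite. -/
theorem gram_posDef {x₀ : M} {z : EuclideanSpace ℝ (Fin n)}
    (hz : z ∈ (extChartAt (𝓡 n) x₀).target) : (gram x₀ z).PosDef := by
  have h1 : LinearIndependent ℝ (fun i ↦ coordVec x₀ z i) := by
    refine Fintype.linearIndependent_iff.2 fun c hc i ↦ ?_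
    have h2 : ∑ i, c i • frame x₀ z (EuclideanSpace.single i (1 : ℝ)) = 0 := hc
    simp only [← map_smul, ← map_sum] at h2
    have h3 := congrArg (coframe x₀ z) h2
    rw [coframe_frame hz, map_zero] at h3
    have h4 := congrArg (fun v : EuclideanSpace ℝ (Fin n) ↦ v i) h3
    simpa [Finset.sum_apply, Pi.single_apply] using h4
  exact Matrix.posDef_gram_of_linearIndependent h1

theorem volDensity_pos {x₀ : M} {z : EuclideanSpace ℝ (Fin n)}
    (hz : z ∈ (extChartAt (𝓡 n) x₀).target) : 0 < volDensity x₀ z :=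
  Real.sqrt_pos.2 (gram_posDef hz).det_pos

omit [IsManifold (𝓡 n) ∞ M] in
theorem metric_frame (x₀ : M) (z v w : EuclideanSpace ℝ (Fin n)) :
    metric ((extChartAt (𝓡 n) x₀).symm z) (frame x₀ z v) (frame x₀ z w) =
      ∑ i, ∑ j, v i * w j * gram x₀ z i j := by
  have hv : ∀ v : EuclideanSpace ℝ (Fin n), v = ∑ i, v i • EuclideanSpace.single i (1 : ℝ) :=
    fun v ↦ by simpa using ((EuclideanSpace.basisFun (Fin n) ℝ).sum_repr v).symm
  conv_lhs => rw [hv v, hv w, map_sum, map_sum]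
  rw [metric_sum_left]
  refine Finset.sum_congr rfl fun i _ ↦ ?_
  rw [metric_sum_right]
  refine Finset.sum_congr rfl fun j _ ↦ ?_
  rw [map_smul, map_smul, metric_smul_left, metric_smul_right, mul_assoc, gram_apply]

/-- If P is the Jacobian matrix, the metric matrices satisfy g₁ = Pᵀ g₀ P; take determinants and
square roots. -/
theorem volDensity_transition {x₁ x₀ : M} {z : EuclideanSpace ℝ (Fin n)}
    (hz : z ∈ overlap x₁ x₀) :
    volDensity x₁ z =
      |(fderiv ℝ (transition x₁ x₀) z).det| * volDensity x₀ (transition x₁ x₀ z) := by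
  classical
  let b := (EuclideanSpace.basisFun (Fin n) ℝ).toBasis
  set D := fderiv ℝ (transition x₁ x₀) z with hD
  set P := LinearMap.toMatrix b b (D : EuclideanSpace ℝ (Fin n) →ₗ[ℝ] EuclideanSpace ℝ (Fin n))
    with hP
  have hPe : ∀ i j, P i j = D (EuclideanSpace.single j 1) i := by
    intro i j
    simp [hP, b, LinearMap.toMatrix_apply]
  have hg : gram x₁ z = P.transpose * gram x₀ (transition x₁ x₀ z) * P := by
    ext i j
    rw [gram_apply, ← frame_transition hz, ← frame_transition hz, ← symm_transition hz,
      metric_frame, Matrix.mul_apply]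
    simp only [Matrix.mul_apply, Matrix.transpose_apply, hPe, Finset.sum_mul]
    rw [Finset.sum_comm]
    refine Finset.sum_congr rfl fun k _ ↦ Finset.sum_congr rfl fun l _ ↦ ?_
    ring
  have hdet : P.det = D.det := by
    rw [hP, LinearMap.det_toMatrix]
  rw [volDensity, volDensity, hg, Matrix.det_mul, Matrix.det_mul, Matrix.det_transpose, hdet,
    mul_comm D.det, mul_assoc, ← sq, mul_comm, Real.sqrt_mul (sq_nonneg _), Real.sqrt_sq_eq_abs]

variable [IsContMDiffRiemannianBundle (𝓡 n) ∞ (EuclideanSpace ℝ (Fin n))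
      (fun x : M ↦ TangentSpace (𝓡 n) x)]

theorem contDiffOn_gram (x₀ : M) (i j : Fin n) :
    ContDiffOn ℝ ∞ (fun z ↦ gram x₀ z i j) (extChartAt (𝓡 n) x₀).target := by
  rw [← contMDiffOn_iff_contDiffOn]
  exact (contMDiffOn_frame x₀ (EuclideanSpace.single i 1)).inner_bundle
    (contMDiffOn_frame x₀ (EuclideanSpace.single j 1))

theorem contDiffOn_det_gram (x₀ : M) :
    ContDiffOn ℝ ∞ (fun z ↦ (gram x₀ z).det) (extChartAt (𝓡 n) x₀).target := by
  simp only [Matrix.det_apply]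
  refine ContDiffOn.sum fun σ _ ↦ ContDiffOn.const_smul _ (contDiffOn_prod fun i _ ↦ ?_)
  exact contDiffOn_gram x₀ _ _

theorem contDiffOn_volDensity (x₀ : M) :
    ContDiffOn ℝ ∞ (volDensity (n := n) x₀) (extChartAt (𝓡 n) x₀).target :=
  (contDiffOn_det_gram x₀).sqrt fun _ hz ↦ (gram_posDef hz).det_pos.ne'

theorem contDiffOn_gram_inv (x₀ : M) (i j : Fin n) :
    ContDiffOn ℝ ∞ (fun z ↦ (gram x₀ z)⁻¹ i j) (extChartAt (𝓡 n) x₀).target := by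
  have : (fun z ↦ (gram x₀ z)⁻¹ i j) =
      -- Cramer's rule writes the entries of the inverse through determinants of smooth entries.
      fun z ↦ ((gram x₀ z).det)⁻¹ * ((gram x₀ z).updateRow j (Pi.single i 1)).det := by
    funext z
    rw [Matrix.inv_def, Matrix.smul_apply, Matrix.adjugate_apply, Ring.inverse_eq_inv', smul_eq_mul]
  rw [this]
  refine ((contDiffOn_det_gram x₀).inv fun _ hz ↦ (gram_posDef hz).det_pos.ne').mul ?_
  simp only [Matrix.det_apply]
  refine ContDiffOn.sum fun σ _ ↦ ContDiffOn.const_smul _ (contDiffOn_prod fun k _ ↦ ?_)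
  simp only [Matrix.updateRow_apply]
  split_ifs
  · exact contDiffOn_const
  · exact contDiffOn_gram x₀ _ _

end Charts

/-! ### The Riemannian volume in charts. -/

section Volume

variable {n : ℕ} {M : Type*} [TopologicalSpace M] [ChartedSpace (EuclideanSpace ℝ (Fin n)) M]
  [MeasurableSpace M] [BorelSpace M]

theorem measurableSet_target_inter_preimage (x₀ : M) {S : Set M} (hS : MeasurableSet S) :
    MeasurableSet ((extChartAt (𝓡 n) x₀).target ∩ (extChartAt (𝓡 n) x₀).symm ⁻¹' S) := by
  classical
  -- The inverse chart is controlled only on the target, so it is replaced by a constant elsewhere.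
  have hm := ContinuousOn.measurable_piecewise (continuousOn_extChartAt_symm (I := 𝓡 n) x₀)
    (continuousOn_const (c := x₀)) (isOpen_extChartAt_target (I := 𝓡 n) x₀).measurableSet
  have : (extChartAt (𝓡 n) x₀).target ∩ (extChartAt (𝓡 n) x₀).symm ⁻¹' S =
      (extChartAt (𝓡 n) x₀).target ∩
        ((extChartAt (𝓡 n) x₀).target.piecewise (extChartAt (𝓡 n) x₀).symm fun _ ↦ x₀) ⁻¹' S := by
    ext z
    simp only [mem_inter_iff, mem_preimage, and_congr_right_iff]
    intro hz
    rw [piecewise_eq_of_mem _ _ _ hz]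
  rw [this]
  exact (isOpen_extChartAt_target x₀).measurableSet.inter (hm hS)

theorem aemeasurable_symm (x₀ : M) : AEMeasurable (extChartAt (𝓡 n) x₀).symm
    (volume.restrict (extChartAt (𝓡 n) x₀).target) :=
  (continuousOn_extChartAt_symm (I := 𝓡 n) x₀).aemeasurable
    (isOpen_extChartAt_target (I := 𝓡 n) x₀).measurableSet

variable [IsManifold (𝓡 n) ∞ M] [RiemannianBundle (fun x : M ↦ TangentSpace (𝓡 n) x)]

omit [IsManifold (𝓡 n) ∞ M] in
theorem aemeasurable_symm_withDensity (x₀ : M) : AEMeasurable (extChartAt (𝓡 n) x₀).symm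
    ((volume.restrict (extChartAt (𝓡 n) x₀).target).withDensity
      (fun z ↦ ENNReal.ofReal (volDensity x₀ z))) :=
  (aemeasurable_symm x₀).mono_ac (withDensity_absolutelyContinuous _ _)

omit [IsManifold (𝓡 n) ∞ M] in
theorem chartVolume_apply (x₀ : M) {S : Set M} (hS : MeasurableSet S) :
    chartVolume (n := n) x₀ S =
      ∫⁻ z in (extChartAt (𝓡 n) x₀).target ∩ (extChartAt (𝓡 n) x₀).symm ⁻¹' S,
        ENNReal.ofReal (volDensity x₀ z) := by
  rw [chartVolume, Measure.map_apply_of_aemeasurable (aemeasurable_symm_withDensity x₀) hS,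
    withDensity_apply₀ _ ((aemeasurable_symm x₀).nullMeasurable hS),
    Measure.restrict_restrict₀ ((aemeasurable_symm x₀).nullMeasurable hS), inter_comm]

/-- Change of variables by the transition map, whose Jacobian is absorbed by
`volDensity_transition`. It is only an inequality because the chart at x₁ may miss part of S. -/
theorem chartVolume_le_chartVolume (x₁ x₀ : M) {S : Set M} (hS : MeasurableSet S)
    (hS₀ : S ⊆ (extChartAt (𝓡 n) x₀).source) :
    chartVolume (n := n) x₁ S ≤ chartVolume (n := n) x₀ S := by
  rw [chartVolume_apply x₁ hS, chartVolume_apply x₀ hS]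
  set A := (extChartAt (𝓡 n) x₁).target ∩ (extChartAt (𝓡 n) x₁).symm ⁻¹' S with hA
  have hAo : A ⊆ overlap x₁ x₀ := fun z hz ↦ ⟨hz.1, hS₀ hz.2⟩
  have hAm : MeasurableSet A := measurableSet_target_inter_preimage x₁ hS
  have hinj : InjOn (transition (n := n) x₁ x₀) A := by
    intro y hy z hz h
    rw [← transition_transition (hAo hy), h, transition_transition (hAo hz)]
  have hd : ∀ z ∈ A, HasFDerivWithinAt (transition x₁ x₀) (fderiv ℝ (transition x₁ x₀) z) A z :=
    fun z hz ↦ ((contDiffAt_transition (hAo hz)).differentiableAt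
      (by simp)).hasFDerivAt.hasFDerivWithinAt
  calc ∫⁻ z in A, ENNReal.ofReal (volDensity x₁ z)
      = ∫⁻ z in A, ENNReal.ofReal |(fderiv ℝ (transition x₁ x₀) z).det| *
          ENNReal.ofReal (volDensity x₀ (transition x₁ x₀ z)) := by
        refine setLIntegral_congr_fun hAm fun z hz ↦ ?_
        rw [volDensity_transition (hAo hz), ENNReal.ofReal_mul (abs_nonneg _)]
    _ = ∫⁻ z in transition x₁ x₀ '' A, ENNReal.ofReal (volDensity x₀ z) :=
        (lintegral_image_eq_lintegral_abs_det_fderiv_mul volume hAm hd hinj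
          fun z ↦ ENNReal.ofReal (volDensity x₀ z)).symm
    _ ≤ _ := by
        refine lintegral_mono_set ?_
        rintro _ ⟨z, hz, rfl⟩
        refine ⟨(transition_mem_overlap (hAo hz)).1, ?_⟩
        rw [mem_preimage, symm_transition (hAo hz)]
        exact hz.2

/-- A supremum of measures is not the setwise supremum. It is instead bounded by one measure above
every chart measure: the one of x₀ plus ⊤ restricted to the complement of the chart domain, which
does not charge S. -/
theorem riemannianVolume_apply (x₀ : M) {S : Set M} (hS : MeasurableSet S)
    (hS₀ : S ⊆ (extChartAt (𝓡 n) x₀).source) :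
    riemannianVolume n M S = chartVolume (n := n) x₀ S := by
  refine le_antisymm ?_ (le_iSup (fun x₀ : M ↦ chartVolume (n := n) x₀) x₀ S)
  have hm : MeasurableSet (extChartAt (𝓡 n) x₀).source :=
    (isOpen_extChartAt_source (I := 𝓡 n) x₀).measurableSet
  have hle : riemannianVolume n M ≤ chartVolume (n := n) x₀ +
      (⊤ : Measure M).restrict (extChartAt (𝓡 n) x₀).sourceᶜ := by
    refine iSup_le fun x₁ ↦ Measure.le_iff.2 fun R hR ↦ ?_
    rw [← measure_inter_add_sdiff R hm, Measure.add_apply]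
    refine add_le_add ?_ ?_
    · exact (chartVolume_le_chartVolume x₁ x₀ (hR.inter hm) inter_subset_right).trans
        (measure_mono inter_subset_left)
    · rw [Measure.restrict_apply hR, sdiff_eq]
      exact (le_top : chartVolume (n := n) x₁ ≤ ⊤) _
  refine (hle S).trans ?_
  rw [Measure.add_apply, Measure.restrict_apply hS, ← sdiff_eq, sdiff_eq_empty.2 hS₀]
  simp

theorem restrict_riemannianVolume (x₀ : M) :
    (riemannianVolume n M).restrict (extChartAt (𝓡 n) x₀).source = chartVolume (n := n) x₀ := by
  have hm : MeasurableSet (extChartAt (𝓡 n) x₀).source :=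
    (isOpen_extChartAt_source (I := 𝓡 n) x₀).measurableSet
  ext S hS
  rw [Measure.restrict_apply hS, riemannianVolume_apply x₀ (hS.inter hm) inter_subset_right,
    chartVolume_apply x₀ (hS.inter hm), chartVolume_apply x₀ hS]
  congr 2
  ext z
  simp only [mem_inter_iff, mem_preimage, and_congr_right_iff, and_iff_left_iff_imp]
  exact fun hz _ ↦ (extChartAt (𝓡 n) x₀).map_target hz

variable [IsContMDiffRiemannianBundle (𝓡 n) ∞ (EuclideanSpace ℝ (Fin n))
      (fun x : M ↦ TangentSpace (𝓡 n) x)]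

theorem setIntegral_riemannianVolume (x₀ : M) {g : M → ℝ}
    (hg : AEStronglyMeasurable g (riemannianVolume n M)) :
    ∫ x in (extChartAt (𝓡 n) x₀).source, g x ∂(riemannianVolume n M) =
      ∫ z in (extChartAt (𝓡 n) x₀).target, volDensity x₀ z * g ((extChartAt (𝓡 n) x₀).symm z) := by
  have hg' : AEStronglyMeasurable g (chartVolume (n := n) x₀) := by
    rw [← restrict_riemannianVolume]
    exact hg.restrict
  rw [restrict_riemannianVolume, chartVolume, integral_map (aemeasurable_symm_withDensity x₀) hg']
  have hm : AEMeasurable (fun z ↦ (volDensity x₀ z).toNNReal)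
      (volume.restrict (extChartAt (𝓡 n) x₀).target) :=
    (((contDiffOn_volDensity (n := n) x₀).continuousOn).aemeasurable
      (isOpen_extChartAt_target (I := 𝓡 n) x₀).measurableSet).real_toNNReal
  have := integral_withDensity_eq_integral_smul₀ hm
    (fun z ↦ g ((extChartAt (𝓡 n) x₀).symm z))
  refine this.trans ?_
  refine setIntegral_congr_fun (isOpen_extChartAt_target (I := 𝓡 n) x₀).measurableSet fun z hz ↦ ?_
  simp only [NNReal.smul_def, smul_eq_mul]
  rw [Real.coe_toNNReal _ (volDensity_pos hz).le]

theorem isLocallyFiniteMeasure_riemannianVolume :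
    IsLocallyFiniteMeasure (riemannianVolume n M) := by
  refine ⟨fun x₀ ↦ ?_⟩
  obtain ⟨K, hK, hKc, hKT⟩ := local_compact_nhds (extChartAt_target_mem_nhds (I := 𝓡 n) x₀)
  have hS : IsOpen ((extChartAt (𝓡 n) x₀).source ∩ extChartAt (𝓡 n) x₀ ⁻¹' interior K) :=
    (continuousOn_extChartAt x₀).isOpen_inter_preimage (isOpen_extChartAt_source x₀)
      isOpen_interior
  refine ⟨_, hS.mem_nhds ⟨mem_extChartAt_source x₀, mem_interior_iff_mem_nhds.2 hK⟩, ?_⟩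
  rw [riemannianVolume_apply x₀ hS.measurableSet inter_subset_left,
    chartVolume_apply x₀ hS.measurableSet]
  have hi : IntegrableOn (volDensity (n := n) x₀) K :=
    ((contDiffOn_volDensity (n := n) x₀).continuousOn.mono hKc).integrableOn_compact hKT
  refine lt_of_le_of_lt (lintegral_mono_set ?_) hi.lintegral_lt_top
  rintro z ⟨hz, hz'⟩
  have := interior_subset hz'.2
  rwa [(extChartAt (𝓡 n) x₀).right_inv hz] at this

theorem ae_riemannianVolume [CompactSpace M] {P : M → Prop} (hP : MeasurableSet {x | P x})
    (h : ∀ x₀ : M, ∀ᵐ z : EuclideanSpace ℝ (Fin n), z ∈ (extChartAt (𝓡 n) x₀).target →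
      P ((extChartAt (𝓡 n) x₀).symm z)) :
    ∀ᵐ x ∂(riemannianVolume n M), P x := by
  have h1 : ∀ x₀ : M, ∀ᵐ x ∂(riemannianVolume n M).restrict (extChartAt (𝓡 n) x₀).source, P x := by
    intro x₀
    rw [restrict_riemannianVolume, chartVolume, ae_map_iff (aemeasurable_symm_withDensity x₀) hP]
    refine (withDensity_absolutelyContinuous _ _).ae_le ?_
    exact (ae_restrict_iff' (isOpen_extChartAt_target (I := 𝓡 n) x₀).measurableSet).2 (h x₀)
  obtain ⟨t, ht⟩ := isCompact_univ.elim_finite_subcover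
    (fun x₀ : M ↦ (extChartAt (𝓡 n) x₀).source) (fun x₀ ↦ isOpen_extChartAt_source x₀)
    (fun x _ ↦ mem_iUnion.2 ⟨x, mem_extChartAt_source x⟩)
  have h2 : ∀ᵐ x ∂(riemannianVolume n M).restrict (⋃ x₀ ∈ t, (extChartAt (𝓡 n) x₀).source), P x :=
    (ae_restrict_biUnion_finset_iff _ t _).2 fun x₀ _ ↦ h1 x₀
  rwa [univ_subset_iff.1 ht, Measure.restrict_univ] at h2

end Volume

/-! ### Chart invariance of the divergence, the divergence theorem, integration by parts. -/

section Divergence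

variable {n : ℕ} {M : Type*} [TopologicalSpace M] [ChartedSpace (EuclideanSpace ℝ (Fin n)) M]

/-- A function is continuous if its coordinate expressions are. -/
theorem continuous_of_continuousOn_chart {X : Type*} [TopologicalSpace X] {g : M → X}
    (h : ∀ x₀ : M, ContinuousOn (fun z ↦ g ((extChartAt (𝓡 n) x₀).symm z))
      (extChartAt (𝓡 n) x₀).target) : Continuous g := by
  refine continuous_iff_continuousAt.2 fun x₀ ↦ ?_
  have h1 : ContinuousAt (fun z ↦ g ((extChartAt (𝓡 n) x₀).symm z)) (extChartAt (𝓡 n) x₀ x₀) :=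
    (h x₀).continuousAt (extChartAt_target_mem_nhds x₀)
  have h2 := ContinuousAt.comp (f := extChartAt (𝓡 n) x₀) (x := x₀) h1 (continuousAt_extChartAt x₀)
  refine h2.congr ?_
  filter_upwards [extChartAt_source_mem_nhds (I := 𝓡 n) x₀] with x hx
  simp only [Function.comp_apply]
  rw [(extChartAt (𝓡 n) x₀).left_inv hx]

/-- A vector field is coordinatewise differentiable if its components are differentiable in every
preferred chart. -/
def CoordDifferentiable (Y : ∀ x : M, TangentSpace (𝓡 n) x) : Prop :=
  ∀ x₀ : M, ∀ z ∈ (extChartAt (𝓡 n) x₀).target, DifferentiableAt ℝ (coordComp Y x₀) z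

/-- The derivative of a function along a vector field. -/
def dirDeriv (h : M → ℝ) (Y : ∀ x : M, TangentSpace (𝓡 n) x) (x : M) : ℝ :=
  mfderiv (𝓡 n) 𝓘(ℝ, ℝ) h x (Y x)

theorem coordComp_smul (h : M → ℝ) (Y : ∀ x : M, TangentSpace (𝓡 n) x) (x₀ : M)
    (z : EuclideanSpace ℝ (Fin n)) :
    coordComp (fun x ↦ h x • Y x) x₀ z =
      h ((extChartAt (𝓡 n) x₀).symm z) • coordComp Y x₀ z :=
  map_smul (mfderiv (𝓡 n) 𝓘(ℝ, EuclideanSpace ℝ (Fin n)) (extChartAt (𝓡 n) x₀)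
    ((extChartAt (𝓡 n) x₀).symm z)) _ _

theorem coordComp_eq_zero {Y : ∀ x : M, TangentSpace (𝓡 n) x} {x₀ : M}
    {z : EuclideanSpace ℝ (Fin n)} (h : Y ((extChartAt (𝓡 n) x₀).symm z) = 0) :
    coordComp Y x₀ z = 0 := by
  rw [coordComp, h]
  exact map_zero (mfderiv (𝓡 n) 𝓘(ℝ, EuclideanSpace ℝ (Fin n)) (extChartAt (𝓡 n) x₀)
    ((extChartAt (𝓡 n) x₀).symm z))

variable [IsManifold (𝓡 n) ∞ M]

theorem contDiffOn_comp_symm {V : Type*} [NormedAddCommGroup V] [NormedSpace ℝ V] {k : ℕ∞}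
    {h : M → V} (hh : ContMDiff (𝓡 n) 𝓘(ℝ, V) k h) (x₀ : M) :
    ContDiffOn ℝ k (fun z ↦ h ((extChartAt (𝓡 n) x₀).symm z)) (extChartAt (𝓡 n) x₀).target := by
  rw [← contMDiffOn_iff_contDiffOn]
  have : IsManifold (𝓡 n) k M := IsManifold.of_le (n := ∞) (mod_cast le_top)
  exact hh.comp_contMDiffOn (contMDiffOn_extChartAt_symm (I := 𝓡 n) x₀)

theorem dirDeriv_symm {h : M → ℝ} (hh : ContMDiff (𝓡 n) 𝓘(ℝ, ℝ) 1 h)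
    (Y : ∀ x : M, TangentSpace (𝓡 n) x) {x₀ : M} {z : EuclideanSpace ℝ (Fin n)}
    (hz : z ∈ (extChartAt (𝓡 n) x₀).target) :
    dirDeriv h Y ((extChartAt (𝓡 n) x₀).symm z) =
      fderiv ℝ (fun z ↦ h ((extChartAt (𝓡 n) x₀).symm z)) z (coordComp Y x₀ z) := by
  have h1 : HasMFDerivAt (𝓡 n) 𝓘(ℝ, ℝ) h ((extChartAt (𝓡 n) x₀).symm z)
      (mfderiv (𝓡 n) 𝓘(ℝ, ℝ) h ((extChartAt (𝓡 n) x₀).symm z)) :=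
    (hh.mdifferentiable (by simp) _).hasMFDerivAt
  have h2 : HasMFDerivAt 𝓘(ℝ, EuclideanSpace ℝ (Fin n)) (𝓡 n) (extChartAt (𝓡 n) x₀).symm z
      (frame x₀ z) := (mdifferentiableAt_symm hz).hasMFDerivAt
  let L : EuclideanSpace ℝ (Fin n) →L[ℝ] ℝ :=
    mfderiv (𝓡 n) 𝓘(ℝ, ℝ) h ((extChartAt (𝓡 n) x₀).symm z)
  have h3 : HasMFDerivAt 𝓘(ℝ, EuclideanSpace ℝ (Fin n)) 𝓘(ℝ, ℝ)
      (fun z ↦ h ((extChartAt (𝓡 n) x₀).symm z)) z (L ∘L frame x₀ z) := h1.comp z h2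
  have h4 : HasFDerivAt (fun z ↦ h ((extChartAt (𝓡 n) x₀).symm z)) (L ∘L frame x₀ z) z :=
    hasMFDerivAt_iff_hasFDerivAt.1 h3
  replace h3 := h4.fderiv
  rw [h3, ContinuousLinearMap.comp_apply]
  exact congrArg L (frame_coframe hz (Y ((extChartAt (𝓡 n) x₀).symm z))).symm

theorem CoordDifferentiable.smul {h : M → ℝ} (hh : ContMDiff (𝓡 n) 𝓘(ℝ, ℝ) 1 h)
    {Y : ∀ x : M, TangentSpace (𝓡 n) x} (hY : CoordDifferentiable Y) :
    CoordDifferentiable (fun x ↦ h x • Y x) := by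
  intro x₀ z hz
  have : coordComp (fun x ↦ h x • Y x) x₀ =
      fun z ↦ h ((extChartAt (𝓡 n) x₀).symm z) • coordComp Y x₀ z :=
    funext fun z ↦ coordComp_smul h Y x₀ z
  rw [this]
  exact (((contDiffOn_comp_symm (k := 1) hh x₀).contDiffAt
    ((isOpen_extChartAt_target x₀).mem_nhds hz)).differentiableAt (by simp)).smul (hY x₀ z hz)

theorem continuous_dirDeriv {h : M → ℝ} (hh : ContMDiff (𝓡 n) 𝓘(ℝ, ℝ) 1 h)
    {Y : ∀ x : M, TangentSpace (𝓡 n) x} (hY : CoordDifferentiable Y) :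
    Continuous (dirDeriv h Y) := by
  refine continuous_of_continuousOn_chart (n := n) fun x₀ ↦ ?_
  have h1 : ContinuousOn (fun z ↦ fderiv ℝ (fun z ↦ h ((extChartAt (𝓡 n) x₀).symm z)) z
      (coordComp Y x₀ z)) (extChartAt (𝓡 n) x₀).target :=
    ((contDiffOn_comp_symm (k := 1) hh x₀).continuousOn_fderiv_of_isOpen
      (isOpen_extChartAt_target x₀) (by simp)).clm_apply
      fun z hz ↦ (hY x₀ z hz).continuousAt.continuousWithinAt
  exact h1.congr fun z hz ↦ dirDeriv_symm hh Y hz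

variable [RiemannianBundle (fun x : M ↦ TangentSpace (𝓡 n) x)]

/-- The vector density `√(det g) Y` in the preferred chart at `x₀`. -/
def coordDensity (Y : ∀ x : M, TangentSpace (𝓡 n) x) (x₀ : M) (z : EuclideanSpace ℝ (Fin n)) :
    EuclideanSpace ℝ (Fin n) :=
  volDensity x₀ z • coordComp Y x₀ z

omit [IsManifold (𝓡 n) ∞ M] in
theorem inner_grad (h : M → ℝ) (Y : ∀ x : M, TangentSpace (𝓡 n) x) (x : M) :
    inner ℝ (grad h x) (Y x) = dirDeriv h Y x := by
  have : FiniteDimensional ℝ (TangentSpace (𝓡 n) x) :=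
    inferInstanceAs (FiniteDimensional ℝ (EuclideanSpace ℝ (Fin n)))
  have : CompleteSpace (TangentSpace (𝓡 n) x) := FiniteDimensional.complete ℝ _
  exact InnerProductSpace.toDual_symm_apply

variable [IsContMDiffRiemannianBundle (𝓡 n) ∞ (EuclideanSpace ℝ (Fin n))
      (fun x : M ↦ TangentSpace (𝓡 n) x)]

theorem CoordDifferentiable.differentiableAt_coordDensity {Y : ∀ x : M, TangentSpace (𝓡 n) x}
    (hY : CoordDifferentiable Y) {x₀ : M} {z : EuclideanSpace ℝ (Fin n)}
    (hz : z ∈ (extChartAt (𝓡 n) x₀).target) : DifferentiableAt ℝ (coordDensity Y x₀) z :=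
  (((contDiffOn_volDensity x₀).contDiffAt
    ((isOpen_extChartAt_target x₀).mem_nhds hz)).differentiableAt (by simp)).smul (hY x₀ z hz)

theorem divergence_eq_trace {Y : ∀ x : M, TangentSpace (𝓡 n) x} (hY : CoordDifferentiable Y)
    (x : M) : divergence Y x = (volDensity x (extChartAt (𝓡 n) x x))⁻¹ *
      LinearMap.trace ℝ _ (fderiv ℝ (coordDensity Y x) (extChartAt (𝓡 n) x x) :
        EuclideanSpace ℝ (Fin n) →ₗ[ℝ] EuclideanSpace ℝ (Fin n)) := by
  rw [divergence, trace_euclideanSpace]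
  congr 1
  refine Finset.sum_congr rfl fun i _ ↦ ?_
  have h1 := (hY.differentiableAt_coordDensity (mem_extChartAt_target (I := 𝓡 n) x)).hasFDerivAt
  have h2 := ((EuclideanSpace.proj i : EuclideanSpace ℝ (Fin n) →L[ℝ] ℝ).hasFDerivAt.comp _ h1)
  have h3 := h2.fderiv
  exact DFunLike.congr_fun h3 (EuclideanSpace.single i (1 : ℝ))

/-- The divergence can be computed in any chart. -/
theorem divergence_symm {Y : ∀ x : M, TangentSpace (𝓡 n) x} (hY : CoordDifferentiable Y)
    {x₀ : M} {z : EuclideanSpace ℝ (Fin n)} (hz : z ∈ (extChartAt (𝓡 n) x₀).target) :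
    divergence Y ((extChartAt (𝓡 n) x₀).symm z) = (volDensity x₀ z)⁻¹ *
      LinearMap.trace ℝ _ (fderiv ℝ (coordDensity Y x₀) z :
        EuclideanSpace ℝ (Fin n) →ₗ[ℝ] EuclideanSpace ℝ (Fin n)) := by
  rw [divergence_eq_trace hY]
  set x := (extChartAt (𝓡 n) x₀).symm z with hx
  have hx₀ : x ∈ (extChartAt (𝓡 n) x₀).source := (extChartAt (𝓡 n) x₀).map_target hz
  set y := extChartAt (𝓡 n) x x with hy
  have hys : (extChartAt (𝓡 n) x).symm y = x := extChartAt_to_inv x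
  have hyo : y ∈ overlap x x₀ := ⟨mem_extChartAt_target x, by rw [mem_preimage, hys]; exact hx₀⟩
  have hyz : transition x x₀ y = z := by
    rw [transition, hys, hx]
    exact (extChartAt (𝓡 n) x₀).right_inv hz
  -- The transition leads from the chart at x, in which the divergence at x is defined, to the chart
  -- at x₀. The Piola relation holds because components transform by the Jacobian and densities by
  -- its absolute determinant.
  have key := trace_fderiv_of_piola (V := coordDensity Y x) (W := coordDensity Y x₀)
    ((contDiffAt_transition hyo).of_le (WithTop.coe_le_coe.2 (le_top : (2 : ℕ∞) ≤ ⊤))) (transitionEquiv hyo)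
    (coe_transitionEquiv hyo).symm (hY.differentiableAt_coordDensity hyo.1)
    (by rw [hyz]; exact hY.differentiableAt_coordDensity hz)
    (by
      filter_upwards [(isOpen_overlap x x₀).mem_nhds hyo] with w hw
      rw [coordDensity, coordDensity, map_smul, fderiv_transition_coordComp Y hw,
        volDensity_transition hw, smul_smul])
  rw [hyz] at key
  rw [← key, volDensity_transition hyo, hyz, coe_transitionEquiv]
  have hd : |(fderiv ℝ (transition x x₀) y).det| ≠ 0 := by
    have h1 := volDensity_pos hyo.1
    rw [volDensity_transition hyo] at h1
    exact left_ne_zero_of_mul h1.ne'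
  have hv := (volDensity_pos hz).ne'
  field_simp

theorem divergence_smul {h : M → ℝ} (hh : ContMDiff (𝓡 n) 𝓘(ℝ, ℝ) 1 h)
    {Y : ∀ x : M, TangentSpace (𝓡 n) x} (hY : CoordDifferentiable Y) (x : M) :
    divergence (fun x ↦ h x • Y x) x = h x * divergence Y x + dirDeriv h Y x := by
  have hz := mem_extChartAt_target (I := 𝓡 n) x
  have hx : (extChartAt (𝓡 n) x).symm (extChartAt (𝓡 n) x x) = x := extChartAt_to_inv x
  have h0 : dirDeriv h Y x = dirDeriv h Y ((extChartAt (𝓡 n) x).symm (extChartAt (𝓡 n) x x)) := by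
    rw [hx]
  rw [divergence_eq_trace (hY.smul hh), divergence_eq_trace hY, h0, dirDeriv_symm hh Y hz]
  set z := extChartAt (𝓡 n) x x with hzdef
  have h1 : coordDensity (fun x ↦ h x • Y x) x =
      fun z ↦ h ((extChartAt (𝓡 n) x).symm z) • coordDensity Y x z := by
    funext w
    rw [coordDensity, coordComp_smul, coordDensity, smul_comm]
  have hd : HasFDerivAt (fun z ↦ h ((extChartAt (𝓡 n) x).symm z))
      (fderiv ℝ (fun z ↦ h ((extChartAt (𝓡 n) x).symm z)) z) z :=
    (((contDiffOn_comp_symm (k := 1) hh x).contDiffAt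
      ((isOpen_extChartAt_target x).mem_nhds hz)).differentiableAt (by simp)).hasFDerivAt
  have h2 := (hd.fun_smul (hY.differentiableAt_coordDensity hz).hasFDerivAt).fderiv
  rw [h1, h2, ContinuousLinearMap.toLinearMap_add, map_add, ContinuousLinearMap.toLinearMap_smul,
    map_smul]
  -- The extra term of the product rule is the rank-one map dh ⊗ Y, whose trace is dh(Y).
  have h3 : LinearMap.trace ℝ (EuclideanSpace ℝ (Fin n))
      (((fderiv ℝ (fun z ↦ h ((extChartAt (𝓡 n) x).symm z)) z).smulRight
        (coordDensity Y x z) : EuclideanSpace ℝ (Fin n) →L[ℝ] EuclideanSpace ℝ (Fin n)) :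
        EuclideanSpace ℝ (Fin n) →ₗ[ℝ] EuclideanSpace ℝ (Fin n)) =
      fderiv ℝ (fun z ↦ h ((extChartAt (𝓡 n) x).symm z)) z (coordDensity Y x z) :=
    LinearMap.trace_smulRight _ _
  rw [h3, hx, coordDensity, map_smul, smul_eq_mul, smul_eq_mul]
  have hv := (volDensity_pos hz).ne'
  field_simp

variable [MeasurableSpace M] [BorelSpace M]

omit [IsManifold (𝓡 n) ∞ M] [IsContMDiffRiemannianBundle (𝓡 n) ∞ (EuclideanSpace ℝ (Fin n))
  (fun x : M ↦ TangentSpace (𝓡 n) x)] in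
theorem integral_weightedVolume {f : M → ℝ} (hf : Continuous f) (g : M → ℝ) :
    ∫ x, g x ∂(weightedVolume n f) = ∫ x, Real.exp (-f x) * g x ∂(riemannianVolume n M) := by
  rw [weightedVolume, integral_withDensity_eq_integral_toReal_smul (by fun_prop) (by simp)]
  simp only [ENNReal.toReal_ofReal (Real.exp_pos _).le, smul_eq_mul]

variable [T2Space M] [CompactSpace M]

omit [CompactSpace M] in
/-- The divergence theorem for a vector field supported in the domain of a chart. -/
theorem integral_divergence_of_support_subset {Y : ∀ x : M, TangentSpace (𝓡 n) x}
    (hY : CoordDifferentiable Y) (hd : Continuous (divergence Y)) (x₀ : M) {K : Set M}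
    (hK : IsCompact K) (hKs : K ⊆ (extChartAt (𝓡 n) x₀).source) (h0 : ∀ x ∉ K, Y x = 0) :
    ∫ x, divergence Y x ∂(riemannianVolume n M) = 0 := by
  set T := (extChartAt (𝓡 n) x₀).target with hT
  have hTo : IsOpen T := isOpen_extChartAt_target x₀
  set e := extChartAt (𝓡 n) x₀ with he
  have hL : IsCompact (e '' K) := hK.image_of_continuousOn
    ((continuousOn_extChartAt x₀).mono hKs)
  have hLT : e '' K ⊆ T := by
    rintro _ ⟨x, hx, rfl⟩
    exact e.map_source (hKs hx)
  -- The coordinate density is zero on T outside the compact set `e '' K`, so its extension by zero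
  -- is differentiable on the whole space.
  set F := T.indicator (coordDensity Y x₀) with hF
  have hF0 : ∀ z ∉ e '' K, F z = 0 := by
    intro z hz
    by_cases hzT : z ∈ T
    · have : e.symm z ∉ K := fun h ↦ hz ⟨_, h, e.right_inv hzT⟩
      rw [hF, indicator_of_mem hzT, coordDensity, coordComp_eq_zero (h0 _ this), smul_zero]
    · rw [hF, indicator_of_notMem hzT]
  have hFe : ∀ z ∈ T, F =ᶠ[𝓝 z] coordDensity Y x₀ := fun z hz ↦ by
    filter_upwards [hTo.mem_nhds hz] with w hw
    rw [hF, indicator_of_mem hw]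
  have hFe0 : ∀ z ∉ e '' K, F =ᶠ[𝓝 z] fun _ ↦ 0 := fun z hz ↦ by
    filter_upwards [hL.isClosed.isOpen_compl.mem_nhds hz] with w hw
    exact hF0 w hw
  have hFd : Differentiable ℝ F := by
    intro z
    by_cases hz : z ∈ T
    · exact (hY.differentiableAt_coordDensity hz).congr_of_eventuallyEq (hFe z hz)
    · exact (differentiableAt_const 0).congr_of_eventuallyEq (hFe0 z fun h ↦ hz (hLT h))
  have hFc : HasCompactSupport F := HasCompactSupport.intro hL hF0
  set D : EuclideanSpace ℝ (Fin n) → ℝ := fun z ↦ LinearMap.trace ℝ _ (fderiv ℝ F z :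
        EuclideanSpace ℝ (Fin n) →ₗ[ℝ] EuclideanSpace ℝ (Fin n)) with hD
  have hDT : ∀ z ∈ T, D z = volDensity x₀ z * divergence Y (e.symm z) := by
    intro z hz
    rw [divergence_symm hY hz, mul_inv_cancel_left₀ (volDensity_pos hz).ne', hD]
    simp only
    rw [(hFe z hz).fderiv_eq]
  have hD0 : ∀ z ∉ e '' K, D z = 0 := by
    intro z hz
    simp only [hD]
    rw [(hFe0 z hz).fderiv_eq]
    simp
  have hDi : Integrable D := by
    rw [← integrableOn_iff_integrable_of_support_subset (s := e '' K)]
    · have hc : ContinuousOn (fun z ↦ volDensity x₀ z * divergence Y (e.symm z)) T :=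
        (contDiffOn_volDensity x₀).continuousOn.mul
          (hd.comp_continuousOn (continuousOn_extChartAt_symm x₀))
      exact ((hc.congr hDT).mono hLT).integrableOn_compact hL
    · intro z hz
      by_contra h
      exact hz (hD0 z h)
  -- Outside the chart domain the divergence is computed in the chart at x itself; Y vanishes near x
  -- because K is closed.
  have hsupp : ∀ x, x ∉ e.source → divergence Y x = 0 := by
    intro x hx
    have hxK : x ∉ K := fun h ↦ hx (hKs h)
    have hev : coordDensity Y x =ᶠ[𝓝 (extChartAt (𝓡 n) x x)] fun _ ↦ 0 := by
      have h1 := (continuousAt_extChartAt_symm (I := 𝓡 n) x)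
      have h2 : Kᶜ ∈ 𝓝 ((extChartAt (𝓡 n) x).symm (extChartAt (𝓡 n) x x)) := by
        rw [extChartAt_to_inv]
        exact hK.isClosed.isOpen_compl.mem_nhds hxK
      filter_upwards [h1 h2] with w hw
      rw [coordDensity, coordComp_eq_zero (h0 _ hw), smul_zero]
    rw [divergence_eq_trace hY, hev.fderiv_eq]
    simp
  rw [← setIntegral_eq_integral_of_forall_compl_eq_zero hsupp,
    setIntegral_riemannianVolume x₀ hd.aestronglyMeasurable]
  calc ∫ z in T, volDensity x₀ z * divergence Y (e.symm z)
      = ∫ z in T, D z := setIntegral_congr_fun hTo.measurableSet fun z hz ↦ (hDT z hz).symm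
    _ = ∫ z, D z := setIntegral_eq_integral_of_forall_compl_eq_zero fun z hz ↦
        hD0 z fun h ↦ hz (hLT h)
    _ = 0 := integral_trace_fderiv_eq_zero hFd hFc hDi

omit [T2Space M] in
theorem isFiniteMeasure_riemannianVolume : IsFiniteMeasure (riemannianVolume n M) := by
  have := isLocallyFiniteMeasure_riemannianVolume (n := n) (M := M)
  infer_instance

omit [T2Space M] in
theorem integrable_riemannianVolume {g : M → ℝ} (hg : Continuous g) :
    Integrable g (riemannianVolume n M) := by
  have := isFiniteMeasure_riemannianVolume (n := n) (M := M)
  exact hg.integrable_of_hasCompactSupport (HasCompactSupport.of_compactSpace g)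

/-- The divergence theorem on a closed manifold. -/
theorem integral_divergence {Y : ∀ x : M, TangentSpace (𝓡 n) x}
    (hY : CoordDifferentiable Y) (hd : Continuous (divergence Y)) :
    ∫ x, divergence Y x ∂(riemannianVolume n M) = 0 := by
  obtain ⟨t, ht⟩ := isCompact_univ.elim_finite_subcover
    (fun x₀ : M ↦ (extChartAt (𝓡 n) x₀).source) (fun x₀ ↦ isOpen_extChartAt_source x₀)
    (fun x _ ↦ mem_iUnion.2 ⟨x, mem_extChartAt_source x⟩)
  obtain ⟨ρ, hρ⟩ := SmoothPartitionOfUnity.exists_isSubordinate (𝓡 n) isClosed_univ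
    (fun i : t ↦ (extChartAt (𝓡 n) (i : M)).source) (fun i ↦ isOpen_extChartAt_source _)
    (by
      intro x hx
      obtain ⟨i, hi, hxi⟩ := mem_iUnion₂.1 (ht hx)
      exact mem_iUnion.2 ⟨⟨i, hi⟩, hxi⟩)
  have hρc : ∀ i, ContMDiff (𝓡 n) 𝓘(ℝ, ℝ) 1 (ρ i) := fun i ↦
    (ρ i).contMDiff.of_le (by exact_mod_cast le_top)
  have hsum : ∀ x, ∑ i, ρ i x = 1 := by
    intro x
    rw [← ρ.sum_eq_one (mem_univ x), finsum_eq_sum_of_fintype]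
  have hc : ∀ i, Continuous (divergence (fun x ↦ ρ i x • Y x)) := by
    intro i
    rw [funext (divergence_smul (hρc i) hY)]
    exact ((hρc i).continuous.mul hd).add (continuous_dirDeriv (hρc i) hY)
  have h1 : ∀ i, ∫ x, divergence (fun x ↦ ρ i x • Y x) x ∂(riemannianVolume n M) = 0 := by
    intro i
    refine integral_divergence_of_support_subset (hY.smul (hρc i)) (hc i) (i : M)
      (isClosed_tsupport (ρ i)).isCompact (hρ i) fun x hx ↦ ?_
    rw [image_eq_zero_of_notMem_tsupport hx, zero_smul]
  have h2 : ∀ x, divergence Y x = ∑ i, divergence (fun x ↦ ρ i x • Y x) x := by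
    intro x
    simp_rw [divergence_smul (hρc _) hY, Finset.sum_add_distrib, ← Finset.sum_mul, hsum, one_mul]
    -- These are the derivatives along Y of the partition functions, whose sum is the constant 1.
    suffices h : ∑ i, dirDeriv (ρ i) Y x = 0 by rw [h, add_zero]
    have hz := mem_extChartAt_target (I := 𝓡 n) x
    have hx : x = (extChartAt (𝓡 n) x).symm (extChartAt (𝓡 n) x x) := (extChartAt_to_inv x).symm
    rw [hx]
    simp_rw [dirDeriv_symm (hρc _) Y hz, ← _root_.sum_apply]
    rw [← fderiv_fun_sum fun i _ ↦ ((contDiffOn_comp_symm (k := 1) (hρc i) x).contDiffAt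
      ((isOpen_extChartAt_target x).mem_nhds hz)).differentiableAt (by simp)]
    simp only [hsum]
    simp
  simp_rw [h2]
  rw [integral_finsetSum _ fun i _ ↦ integrable_riemannianVolume (hc i)]
  exact Finset.sum_eq_zero fun i _ ↦ h1 i

omit [T2Space M] in
theorem integrable_weightedVolume {f : M → ℝ} (hf : Continuous f) {g : M → ℝ} (hg : Continuous g) :
    Integrable g (weightedVolume n f) := by
  rw [weightedVolume, integrable_withDensity_iff_integrable_smul' (by fun_prop) (by simp)]
  refine integrable_riemannianVolume ?_
  simp only [ENNReal.toReal_ofReal (Real.exp_pos _).le]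
  fun_prop

/-- Integration by parts for the weighted divergence. -/
theorem integral_mul_weightedDivergence {f : M → ℝ} (hf : ContMDiff (𝓡 n) 𝓘(ℝ, ℝ) 1 f)
    {h : M → ℝ} (hh : ContMDiff (𝓡 n) 𝓘(ℝ, ℝ) 1 h) {Y : ∀ x : M, TangentSpace (𝓡 n) x}
    (hY : CoordDifferentiable Y) (hd : Continuous (weightedDivergence f Y)) :
    ∫ x, h x * weightedDivergence f Y x ∂(weightedVolume n f) =
      -∫ x, inner ℝ (grad h x) (Y x) ∂(weightedVolume n f) := by
  have hw : ContMDiff (𝓡 n) 𝓘(ℝ, ℝ) 1 (fun x ↦ Real.exp (-f x)) :=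
    (Real.contDiff_exp.comp contDiff_neg).comp_contMDiff hf
  have hY' := hY.smul hw
  set Y' : ∀ x : M, TangentSpace (𝓡 n) x := fun x ↦ Real.exp (-f x) • Y x with hY'def
  have hd1 : ∀ x, divergence Y' x = Real.exp (-f x) * weightedDivergence f Y x := by
    intro x
    rw [weightedDivergence, ← mul_assoc, ← Real.exp_add]
    simp [hY'def]
  have hd' : Continuous (divergence Y') := by
    rw [funext hd1]
    exact hw.continuous.mul hd
  have hd2 : Continuous (divergence (fun x ↦ h x • Y' x)) := by
    rw [funext (divergence_smul hh hY')]
    exact (hh.continuous.mul hd').add (continuous_dirDeriv hh hY')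
  -- The divergence theorem is applied to h e^{-f} Y; the weight e^{-f} is exactly the density of μ.
  have key := integral_divergence (hY'.smul hh) hd2
  simp_rw [divergence_smul hh hY'] at key
  have hi : Integrable (fun x ↦ h x * divergence Y' x) (riemannianVolume n M) :=
    integrable_riemannianVolume (hh.continuous.mul hd')
  rw [integral_add hi (integrable_riemannianVolume (continuous_dirDeriv hh hY'))] at key
  rw [integral_weightedVolume hf.continuous, integral_weightedVolume hf.continuous]
  rw [← eq_neg_iff_add_eq_zero] at key
  convert key using 1
  · refine integral_congr_ae (Eventually.of_forall fun x ↦ ?_)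
    simp only
    rw [hd1]
    ring
  · congr 1
    refine integral_congr_ae (Eventually.of_forall fun x ↦ ?_)
    simp only
    rw [inner_grad]
    exact ((mfderiv (𝓡 n) 𝓘(ℝ, ℝ) h x).map_smul (Real.exp (-f x)) (Y x)).symm

end Divergence

/-- The tangent inequality of the convex function `‖·‖ ^ p`. -/
theorem mul_rpow_mul_inner_le {V : Type*} [NormedAddCommGroup V] [InnerProductSpace ℝ V] {p : ℝ}
    (hp : 1 < p) (A B : V) :
    p * (‖A‖ ^ (p - 2) * inner ℝ A B) ≤ ‖B‖ ^ p + (p - 1) * ‖A‖ ^ p := by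
  rcases eq_or_ne A 0 with rfl | hA
  · have : (0 : ℝ) ^ p = 0 := Real.zero_rpow (by linarith)
    simp only [inner_zero_left, mul_zero, norm_zero, this, add_zero]
    positivity
  have hA' : 0 < ‖A‖ := norm_pos_iff.2 hA
  have h1 : ‖A‖ ^ (p - 2) * inner ℝ A B ≤ ‖B‖ * ‖A‖ ^ (p - 1) := by
    calc ‖A‖ ^ (p - 2) * inner ℝ A B ≤ ‖A‖ ^ (p - 2) * (‖A‖ * ‖B‖) := by
          gcongr
          exact real_inner_le_norm A B
      _ = ‖B‖ * ‖A‖ ^ (p - 1) := by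
          rw [show p - 1 = (p - 2) + 1 by ring, Real.rpow_add_one hA'.ne']
          ring
  have hpq : p.HolderConjugate (p / (p - 1)) := Real.HolderConjugate.conjExponent hp
  have h2 := Real.young_inequality_of_nonneg (norm_nonneg B)
    (Real.rpow_nonneg hA'.le (p - 1)) hpq
  have hp1 : p - 1 ≠ 0 := by linarith
  have hp0 : p ≠ 0 := by linarith
  rw [← Real.rpow_mul hA'.le, show (p - 1) * (p / (p - 1)) = p by field_simp] at h2
  have h3 := mul_le_mul_of_nonneg_left (h1.trans h2) (by linarith : 0 ≤ p)
  calc _ ≤ _ := h3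
    _ = _ := by field_simp

/-! ### Regularity of the gradient and of the p-flux. -/

section Flux

variable {n m : ℕ} {M : Type*} [TopologicalSpace M] [ChartedSpace (EuclideanSpace ℝ (Fin n)) M]
  [IsManifold (𝓡 n) ∞ M]

theorem contDiffOn_coordComp_of_contMDiff {Y : ∀ x : M, TangentSpace (𝓡 n) x}
    (hY : ContMDiff (𝓡 n) (𝓡 n).tangent 1 (fun x ↦ (⟨x, Y x⟩ : TangentBundle (𝓡 n) M))) (x₀ : M) :
    ContDiffOn ℝ 1 (coordComp Y x₀) (extChartAt (𝓡 n) x₀).target := by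
  rw [← contMDiffOn_iff_contDiffOn]
  have : IsManifold (𝓡 n) 1 M := IsManifold.of_le (n := ∞) (by simp)
  have hs := contMDiffOn_extChartAt_symm (I := 𝓡 n) (n := 1) x₀
  have h1 := (Trivialization.contMDiffOn_section_baseSet_iff
    (trivializationAt (EuclideanSpace ℝ (Fin n)) (TangentSpace (𝓡 n)) x₀)
    (IB := 𝓡 n) (n := 1) (s := Y)).1 hY.contMDiffOn
  have h2 := h1.comp hs fun z hz ↦ by
    simpa using (extChartAt (𝓡 n) x₀).map_target hz
  refine h2.congr fun z hz ↦ ?_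
  have hx : (extChartAt (𝓡 n) x₀).symm z ∈ (chartAt (EuclideanSpace ℝ (Fin n)) x₀).source := by
    simpa using (extChartAt (𝓡 n) x₀).map_target hz
  rw [coordComp, ← TangentBundle.continuousLinearMapAt_trivializationAt hx]
  simp only [Function.comp_apply]
  exact Trivialization.continuousLinearMapAt_apply_of_mem ℝ _ (by simpa using hx) _

theorem CoordDifferentiable.of_contMDiff {Y : ∀ x : M, TangentSpace (𝓡 n) x}
    (hY : ContMDiff (𝓡 n) (𝓡 n).tangent 1 (fun x ↦ (⟨x, Y x⟩ : TangentBundle (𝓡 n) M))) :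
    CoordDifferentiable Y := fun x₀ _ hz ↦
  ((contDiffOn_coordComp_of_contMDiff hY x₀).contDiffAt
    ((isOpen_extChartAt_target x₀).mem_nhds hz)).differentiableAt (by simp)

variable [RiemannianBundle (fun x : M ↦ TangentSpace (𝓡 n) x)]

/-- The gradient in coordinates. -/
theorem coordComp_grad {h : M → ℝ} (hh : ContMDiff (𝓡 n) 𝓘(ℝ, ℝ) 1 h) {x₀ : M}
    {z : EuclideanSpace ℝ (Fin n)} (hz : z ∈ (extChartAt (𝓡 n) x₀).target) (i : Fin n) :
    coordComp (grad h) x₀ z i = ∑ j, (gram x₀ z)⁻¹ i j *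
      fderiv ℝ (fun z ↦ h ((extChartAt (𝓡 n) x₀).symm z)) z (EuclideanSpace.single j (1 : ℝ)) := by
  set G := coordComp (grad h) x₀ z with hG
  set d : Fin n → ℝ := fun j ↦
    fderiv ℝ (fun z ↦ h ((extChartAt (𝓡 n) x₀).symm z)) z (EuclideanSpace.single j (1 : ℝ)) with hd
  have h1 : ∀ j, ∑ k, G k * gram x₀ z k j = d j := by
    intro j
    set w := frame x₀ z (EuclideanSpace.single j (1 : ℝ)) with hw
    -- `dirDeriv` takes a field but sees only its value at the point, so any extension of w serves.
    obtain ⟨Y, hY⟩ : ∃ Y : ∀ x : M, TangentSpace (𝓡 n) x,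
        ∀ x, (Y x : EuclideanSpace ℝ (Fin n)) = w := ⟨fun _ ↦ w, fun _ ↦ rfl⟩
    have e0 : frame x₀ z G = grad h ((extChartAt (𝓡 n) x₀).symm z) := frame_coframe hz _
    have e1 : metric ((extChartAt (𝓡 n) x₀).symm z) (frame x₀ z G) w =
        dirDeriv h Y ((extChartAt (𝓡 n) x₀).symm z) := by
      rw [← inner_grad, e0, ← hY ((extChartAt (𝓡 n) x₀).symm z)]
      rfl
    have e2 : coordComp Y x₀ z = EuclideanSpace.single j (1 : ℝ) :=
      (congrArg (coframe x₀ z) (hY _)).trans (coframe_frame hz _)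
    rw [dirDeriv_symm hh _ hz, e2, hw, metric_frame] at e1
    refine Eq.trans ?_ e1
    simp
  have h2 : Matrix.vecMul G (gram x₀ z) = d := funext h1
  have h3 : gram x₀ z * (gram x₀ z)⁻¹ = 1 :=
    Matrix.mul_nonsing_inv _ (gram_posDef hz).det_pos.ne'.isUnit
  have h4 : (G : Fin n → ℝ) = Matrix.vecMul d (gram x₀ z)⁻¹ := by
    rw [← h2, Matrix.vecMul_vecMul, h3, Matrix.vecMul_one]
  have hsymm : ((gram x₀ z)⁻¹).transpose = (gram x₀ z)⁻¹ := by
    have := (gram_posDef hz).isHermitian.inv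
    simpa [Matrix.IsHermitian, Matrix.conjTranspose_eq_transpose_of_trivial] using this
  have h5 := congrFun h4 i
  rw [← Matrix.mulVec_transpose, hsymm] at h5
  exact h5

variable [IsContMDiffRiemannianBundle (𝓡 n) ∞ (EuclideanSpace ℝ (Fin n))
      (fun x : M ↦ TangentSpace (𝓡 n) x)]

theorem coordDifferentiable_grad {h : M → ℝ} (hh : ContMDiff (𝓡 n) 𝓘(ℝ, ℝ) ∞ h) :
    CoordDifferentiable (grad h : ∀ x : M, TangentSpace (𝓡 n) x) := by
  intro x₀ z hz
  have ho := (isOpen_extChartAt_target (I := 𝓡 n) x₀)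
  have h1 : ContMDiff (𝓡 n) 𝓘(ℝ, ℝ) 1 h := hh.of_le (by simp)
  rw [differentiableAt_piLp]
  intro i
  have hev : (fun z ↦ coordComp (grad h) x₀ z i) =ᶠ[𝓝 z] fun z ↦ ∑ j, (gram x₀ z)⁻¹ i j *
      fderiv ℝ (fun z ↦ h ((extChartAt (𝓡 n) x₀).symm z)) z (EuclideanSpace.single j (1 : ℝ)) := by
    filter_upwards [ho.mem_nhds hz] with w hw
    exact coordComp_grad h1 hw i
  refine DifferentiableAt.congr_of_eventuallyEq ?_ hev
  refine DifferentiableAt.fun_sum fun j _ ↦ DifferentiableAt.mul ?_ ?_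
  · exact ((contDiffOn_gram_inv x₀ i j).contDiffAt (ho.mem_nhds hz)).differentiableAt (by simp)
  · have h2 := (contDiffOn_comp_symm (k := ⊤) hh x₀).contDiffAt (ho.mem_nhds hz)
    have h3 := (h2.fderiv_right (m := 1) (WithTop.coe_le_coe.2 (le_top : (1 + 1 : ℕ∞) ≤ ⊤))).differentiableAt (by simp)
    exact h3.clm_apply (differentiableAt_const _)

omit [IsManifold (𝓡 n) ∞ M] [IsContMDiffRiemannianBundle (𝓡 n) ∞ (EuclideanSpace ℝ (Fin n))
  (fun x : M ↦ TangentSpace (𝓡 n) x)] in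
-- Writing |∇h|² as dh(∇h) makes its differentiability in a chart follow from that of dh and of the
-- components of ∇h.
theorem norm_grad_sq (h : M → ℝ) (x : M) : ‖grad (n := n) h x‖ ^ 2 = dirDeriv (n := n) h (grad h) x := by
  rw [← inner_grad, real_inner_self_eq_norm_sq]

/-- At critical points of v the square root is not smooth, but there ∇vₖ vanishes too, which is the
situation of `differentiableAt_sqrt_rpow_smul`. -/
theorem coordDifferentiable_pFlux {p : ℝ} (hp : 2 ≤ p) {v : M → EuclideanSpace ℝ (Fin m)}
    (hv : ∀ k, ContMDiff (𝓡 n) 𝓘(ℝ, ℝ) ∞ (fun x ↦ v x k)) (k : Fin m) :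
    CoordDifferentiable (pFlux (n := n) p v k) := by
  intro x₀ z hz
  set q : EuclideanSpace ℝ (Fin n) → ℝ := fun z ↦
    ∑ k, ‖grad (n := n) (fun y ↦ v y k) ((extChartAt (𝓡 n) x₀).symm z)‖ ^ 2 with hq
  have h1 : coordComp (pFlux (n := n) p v k) x₀ = fun z ↦
      Real.sqrt (q z) ^ (p - 2) • coordComp (grad fun y ↦ v y k) x₀ z :=
    funext fun z ↦ coordComp_smul _ _ _ _
  rw [h1]
  have hnn : ∀ z k, 0 ≤ ‖grad (n := n) (fun y ↦ v y k) ((extChartAt (𝓡 n) x₀).symm z)‖ ^ 2 :=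
    fun z k ↦ sq_nonneg _
  refine differentiableAt_sqrt_rpow_smul hp (Finset.sum_nonneg fun k _ ↦ hnn z k) ?_
    (coordDifferentiable_grad (hv k) x₀ z hz) ?_
  · have ho := (isOpen_extChartAt_target (I := 𝓡 n) x₀)
    refine DifferentiableAt.fun_sum fun l _ ↦ ?_
    have hev : (fun z ↦ ‖grad (n := n) (fun y ↦ v y l) ((extChartAt (𝓡 n) x₀).symm z)‖ ^ 2) =ᶠ[𝓝 z]
        fun z ↦ fderiv ℝ (fun z ↦ v ((extChartAt (𝓡 n) x₀).symm z) l) z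
          (coordComp (grad fun y ↦ v y l) x₀ z) := by
      filter_upwards [ho.mem_nhds hz] with w hw
      rw [norm_grad_sq, dirDeriv_symm ((hv l).of_le (by simp)) _ hw]
    refine DifferentiableAt.congr_of_eventuallyEq ?_ hev
    have h2 := (contDiffOn_comp_symm (k := ⊤) (hv l) x₀).contDiffAt (ho.mem_nhds hz)
    have h3 := (h2.fderiv_right (m := 1) (WithTop.coe_le_coe.2 (le_top : (1 + 1 : ℕ∞) ≤ ⊤))).differentiableAt (by simp)
    exact h3.clm_apply (coordDifferentiable_grad (hv l) x₀ z hz)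
  · intro h0
    have h2 := (Finset.sum_eq_zero_iff_of_nonneg fun k _ ↦ hnn z k).1 h0 k (Finset.mem_univ k)
    exact coordComp_eq_zero (norm_eq_zero.1 (pow_eq_zero_iff two_ne_zero |>.1 h2))

theorem weightedDivergence_eq {f : M → ℝ} (hf : ContMDiff (𝓡 n) 𝓘(ℝ, ℝ) 1 f)
    {Y : ∀ x : M, TangentSpace (𝓡 n) x} (hY : CoordDifferentiable Y) (x : M) :
    weightedDivergence f Y x = divergence Y x + Real.exp (f x) *
      dirDeriv (fun x ↦ Real.exp (-f x)) Y x := by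
  have hw : ContMDiff (𝓡 n) 𝓘(ℝ, ℝ) 1 (fun x ↦ Real.exp (-f x)) :=
    (Real.contDiff_exp.comp contDiff_neg).comp_contMDiff hf
  rw [weightedDivergence, divergence_smul hw hY, mul_add, ← mul_assoc, ← Real.exp_add]
  simp

theorem continuous_weightedDivergence {f : M → ℝ} (hf : ContMDiff (𝓡 n) 𝓘(ℝ, ℝ) 1 f)
    {Y : ∀ x : M, TangentSpace (𝓡 n) x}
    (hY : ContMDiff (𝓡 n) (𝓡 n).tangent 1 (fun x ↦ (⟨x, Y x⟩ : TangentBundle (𝓡 n) M))) :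
    Continuous (weightedDivergence f Y) := by
  have hY' := CoordDifferentiable.of_contMDiff hY
  have hw : ContMDiff (𝓡 n) 𝓘(ℝ, ℝ) 1 (fun x ↦ Real.exp (-f x)) :=
    (Real.contDiff_exp.comp contDiff_neg).comp_contMDiff hf
  rw [funext (weightedDivergence_eq hf hY')]
  refine Continuous.add ?_ ((Real.continuous_exp.comp hf.continuous).mul
    (continuous_dirDeriv hw hY'))
  refine continuous_of_continuousOn_chart (n := n) fun x₀ ↦ ?_
  have ho := (isOpen_extChartAt_target (I := 𝓡 n) x₀)
  have h1 : ContDiffOn ℝ 1 (coordDensity Y x₀) (extChartAt (𝓡 n) x₀).target :=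
    ((contDiffOn_volDensity x₀).of_le (by simp)).smul (contDiffOn_coordComp_of_contMDiff hY x₀)
  have h2 := h1.continuousOn_fderiv_of_isOpen ho (by simp)
  refine ContinuousOn.congr (f := fun z ↦ (volDensity x₀ z)⁻¹ *
    ∑ i, fderiv ℝ (coordDensity Y x₀) z (EuclideanSpace.single i (1 : ℝ)) i) ?_ ?_
  · refine ContinuousOn.mul ((contDiffOn_volDensity x₀).continuousOn.inv₀
      fun z hz ↦ (volDensity_pos hz).ne') (continuousOn_finsetSum _ fun i _ ↦ ?_)
    exact (EuclideanSpace.proj i : EuclideanSpace ℝ (Fin n) →L[ℝ] ℝ).continuous.comp_continuousOn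
      (h2.clm_apply continuousOn_const)
  · intro z hz
    simp only
    rw [divergence_symm hY' hz, trace_euclideanSpace]
    rfl

/-- The `p`-Laplacian vanishes almost everywhere on the zero set of the function. -/
theorem ae_weightedDivergence_pFlux_eq_zero [CompactSpace M] [MeasurableSpace M] [BorelSpace M]
    {f : M → ℝ} (hf : ContMDiff (𝓡 n) 𝓘(ℝ, ℝ) 1 f) {p : ℝ} {v : M → EuclideanSpace ℝ (Fin m)}
    (hv : ∀ k, ContMDiff (𝓡 n) 𝓘(ℝ, ℝ) ∞ (fun x ↦ v x k)) (k : Fin m)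
    (hY : ContMDiff (𝓡 n) (𝓡 n).tangent 1
      (fun x ↦ (⟨x, pFlux p v k x⟩ : TangentBundle (𝓡 n) M))) :
    ∀ᵐ x ∂(riemannianVolume n M), v x = 0 → weightedDivergence f (pFlux (n := n) p v k) x = 0 := by
  have hY' := CoordDifferentiable.of_contMDiff hY
  have hvc : Continuous v := by
    have : Continuous fun x ↦ WithLp.toLp 2 fun k ↦ v x k :=
      (PiLp.continuous_toLp 2 _).comp (continuous_pi fun k ↦ (hv k).continuous)
    exact this
  have hw : ContMDiff (𝓡 n) 𝓘(ℝ, ℝ) 1 (fun x ↦ Real.exp (-f x)) :=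
    (Real.contDiff_exp.comp contDiff_neg).comp_contMDiff hf
  refine ae_riemannianVolume (n := n) ?_ fun x₀ ↦ ?_
  · have h1 : MeasurableSet {x : M | v x = 0} := (isClosed_eq hvc continuous_const).measurableSet
    have h2 : MeasurableSet {x : M | weightedDivergence f (pFlux (n := n) p v k) x = 0} :=
      (isClosed_eq (continuous_weightedDivergence hf hY) continuous_const).measurableSet
    have : {x : M | v x = 0 → weightedDivergence f (pFlux (n := n) p v k) x = 0} =
        {x : M | v x = 0}ᶜ ∪ {x | weightedDivergence f (pFlux (n := n) p v k) x = 0} := by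
      ext x
      simp [imp_iff_not_or]
    rw [this]
    exact h1.compl.union h2
  · have ho := (isOpen_extChartAt_target (I := 𝓡 n) x₀)
    -- The zero-set lemma is used twice. For the components of v it shows that ∇v, hence the flux,
    -- vanishes at almost every zero of v; for the flux density it shows that almost everywhere
    -- there the derivative of the density vanishes as well.
    have h1 : ∀ᵐ z : EuclideanSpace ℝ (Fin n), ∀ l : Fin m, z ∈ (extChartAt (𝓡 n) x₀).target →
        v ((extChartAt (𝓡 n) x₀).symm z) l = 0 →
        fderiv ℝ (fun z ↦ v ((extChartAt (𝓡 n) x₀).symm z) l) z = 0 := by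
      refine ae_all_iff.2 fun l ↦ ae_fderiv_eq_zero_of_eq_zero volume ho fun z hz ↦ ?_
      exact ((contDiffOn_comp_symm (k := ⊤) (hv l) x₀).contDiffAt
        (ho.mem_nhds hz)).differentiableAt (by simp)
    have h2 : ∀ᵐ z : EuclideanSpace ℝ (Fin n), ∀ i : Fin n, z ∈ (extChartAt (𝓡 n) x₀).target →
        coordDensity (pFlux (n := n) p v k) x₀ z i = 0 →
        fderiv ℝ (fun z ↦ coordDensity (pFlux (n := n) p v k) x₀ z i) z = 0 := by
      refine ae_all_iff.2 fun i ↦ ae_fderiv_eq_zero_of_eq_zero volume ho fun z hz ↦ ?_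
      exact differentiableAt_piLp _ |>.1 (hY'.differentiableAt_coordDensity hz) i
    filter_upwards [h1, h2] with z hz1 hz2 hz hv0
    have hflux : coordComp (pFlux (n := n) p v k) x₀ z = 0 := by
      have h3 : coordComp (grad fun y ↦ v y k) x₀ z = 0 := by
        ext i
        rw [coordComp_grad ((hv k).of_le (by simp)) hz, hz1 k hz (by rw [hv0]; rfl)]
        simp
      have h4 : coordComp (pFlux (n := n) p v k) x₀ z =
          gradNorm (n := n) v ((extChartAt (𝓡 n) x₀).symm z) ^ (p - 2) •
            coordComp (grad fun y ↦ v y k) x₀ z := coordComp_smul _ _ _ _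
      rw [h4, h3, smul_zero]
    have hdens : coordDensity (pFlux (n := n) p v k) x₀ z = 0 := by
      rw [coordDensity, hflux, smul_zero]
    have hD : ∀ i, fderiv ℝ (coordDensity (pFlux (n := n) p v k) x₀) z
        (EuclideanSpace.single i (1 : ℝ)) i = 0 := by
      intro i
      have h3 := (hY'.differentiableAt_coordDensity hz).hasFDerivAt
      have h4 := ((EuclideanSpace.proj i : EuclideanSpace ℝ (Fin n) →L[ℝ] ℝ).hasFDerivAt.comp _
        h3).fderiv
      have h5 := hz2 i hz (by rw [hdens]; rfl)
      have h6 := DFunLike.congr_fun h4 (EuclideanSpace.single i (1 : ℝ))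
      refine h6.symm.trans ?_
      exact DFunLike.congr_fun h5 (EuclideanSpace.single i (1 : ℝ))
    rw [weightedDivergence_eq hf hY', divergence_symm hY' hz, dirDeriv_symm hw _ hz, hflux,
      trace_euclideanSpace]
    simp [hD]

end Flux

/-! ### Green's formula and convexity of the p-energy. -/

section Energy

variable {n m : ℕ} {M : Type*} [TopologicalSpace M] [ChartedSpace (EuclideanSpace ℝ (Fin n)) M]
  [RiemannianBundle (fun x : M ↦ TangentSpace (𝓡 n) x)]

/-- The density `|∇v| ^ (p - 2) ⟨∇w, ∇v⟩`. -/
def crossDensity (p : ℝ) (w v : M → EuclideanSpace ℝ (Fin m)) (x : M) : ℝ :=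
  ∑ k, inner ℝ (grad (n := n) (fun y ↦ w y k) x) (pFlux (n := n) p v k x)

/-- The m gradients at x form one vector in the ℓ² sum of m copies of the tangent space, with norm
`gradNorm`; the claim is the tangent inequality of ‖·‖^p there. -/
theorem mul_crossDensity_le {p : ℝ} (hp : 1 < p) (w v : M → EuclideanSpace ℝ (Fin m)) (x : M) :
    p * crossDensity (n := n) p w v x ≤
      crossDensity (n := n) p w w x + (p - 1) * crossDensity (n := n) p v v x := by
  let g : (M → EuclideanSpace ℝ (Fin m)) → PiLp 2 fun _ : Fin m ↦ TangentSpace (𝓡 n) x :=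
    fun w ↦ WithLp.toLp 2 fun k ↦ grad (n := n) (fun y ↦ w y k) x
  have hg : ∀ v, gradNorm (n := n) v x = ‖g v‖ := fun v ↦ (PiLp.norm_eq_of_L2 (g v)).symm
  have hc : ∀ w v, crossDensity (n := n) p w v x = ‖g v‖ ^ (p - 2) * inner ℝ (g v) (g w) := by
    intro w v
    rw [crossDensity, PiLp.inner_apply, Finset.mul_sum]
    refine Finset.sum_congr rfl fun k _ ↦ ?_
    rw [pFlux, real_inner_smul_right, hg, real_inner_comm]
  have hs : ∀ v, crossDensity (n := n) p v v x = ‖g v‖ ^ p := by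
    intro v
    rw [hc, real_inner_self_eq_norm_sq]
    exact rpow_sub_two_mul_sq hp (g v)
  rw [hs, hs, hc]
  exact mul_rpow_mul_inner_le hp (g v) (g w)

variable [IsManifold (𝓡 n) ∞ M]
  [IsContMDiffRiemannianBundle (𝓡 n) ∞ (EuclideanSpace ℝ (Fin n))
      (fun x : M ↦ TangentSpace (𝓡 n) x)]

omit [IsContMDiffRiemannianBundle (𝓡 n) ∞ (EuclideanSpace ℝ (Fin n))
  (fun x : M ↦ TangentSpace (𝓡 n) x)] in
theorem continuous_crossDensity {p : ℝ} {w v : M → EuclideanSpace ℝ (Fin m)}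
    (hw : ∀ k, ContMDiff (𝓡 n) 𝓘(ℝ, ℝ) ∞ (fun x ↦ w x k))
    (hv : ∀ k, CoordDifferentiable (pFlux (n := n) p v k)) :
    Continuous (crossDensity (n := n) p w v) := by
  refine continuous_finsetSum _ fun k _ ↦ ?_
  simp_rw [inner_grad]
  exact continuous_dirDeriv ((hw k).of_le (by simp)) (hv k)

variable [T2Space M] [CompactSpace M] [MeasurableSpace M] [BorelSpace M]

/-- Green's formula for the weighted `p`-Laplacian. -/
theorem integral_inner_weightedPLaplacian {f : M → ℝ} (hf : ContMDiff (𝓡 n) 𝓘(ℝ, ℝ) 1 f) {p : ℝ}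
    {w v : M → EuclideanSpace ℝ (Fin m)}
    (hw : ∀ k, ContMDiff (𝓡 n) 𝓘(ℝ, ℝ) ∞ (fun x ↦ w x k))
    (hv : ∀ k, CoordDifferentiable (pFlux (n := n) p v k))
    (hc : ∀ k, Continuous (weightedDivergence f (pFlux (n := n) p v k))) :
    ∫ x, inner ℝ (w x) (weightedPLaplacian n p f v x) ∂(weightedVolume n f) =
      -∫ x, crossDensity (n := n) p w v x ∂(weightedVolume n f) := by
  have h1 : ∀ k, ContMDiff (𝓡 n) 𝓘(ℝ, ℝ) 1 (fun x ↦ w x k) := fun k ↦ (hw k).of_le (by simp)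
  have h2 : ∀ x, inner ℝ (w x) (weightedPLaplacian n p f v x) =
      ∑ k, w x k * weightedDivergence f (pFlux (n := n) p v k) x := by
    intro x
    rw [PiLp.inner_apply]
    refine Finset.sum_congr rfl fun k _ ↦ ?_
    rw [weightedPLaplacian]
    simp [mul_comm]
  simp_rw [h2, crossDensity]
  have h3 : ∀ k, Integrable (fun x ↦ w x k * weightedDivergence f (pFlux (n := n) p v k) x)
      (weightedVolume n f) := fun k ↦
    integrable_weightedVolume hf.continuous ((h1 k).continuous.mul (hc k))
  rw [integral_finsetSum _ fun k _ ↦ h3 k, integral_finsetSum, ← Finset.sum_neg_distrib]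
  · exact Finset.sum_congr rfl fun k _ ↦ integral_mul_weightedDivergence hf (h1 k) (hv k) (hc k)
  · intro k _
    refine integrable_weightedVolume hf.continuous ?_
    simp_rw [inner_grad]
    exact continuous_dirDeriv (h1 k) (hv k)

/-- The convexity inequality of the `p`-energy. -/
theorem integral_inner_weightedPLaplacian_le {f : M → ℝ} (hf : ContMDiff (𝓡 n) 𝓘(ℝ, ℝ) 1 f)
    {p : ℝ} (hp : 1 < p) {w v : M → EuclideanSpace ℝ (Fin m)}
    (hw : ∀ k, ContMDiff (𝓡 n) 𝓘(ℝ, ℝ) ∞ (fun x ↦ w x k))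
    (hv : ∀ k, ContMDiff (𝓡 n) 𝓘(ℝ, ℝ) ∞ (fun x ↦ v x k))
    (hwd : ∀ k, CoordDifferentiable (pFlux (n := n) p w k))
    (hvd : ∀ k, CoordDifferentiable (pFlux (n := n) p v k))
    (hwc : ∀ k, Continuous (weightedDivergence f (pFlux (n := n) p w k)))
    (hvc : ∀ k, Continuous (weightedDivergence f (pFlux (n := n) p v k))) :
    ∫ x, inner ℝ (w x) (weightedPLaplacian n p f w x) ∂(weightedVolume n f) ≤
      ∫ x, inner ℝ (v x) (weightedPLaplacian n p f v x) ∂(weightedVolume n f) +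
        p * ∫ x, inner ℝ (weightedPLaplacian n p f v x) (w x - v x) ∂(weightedVolume n f) := by
  have hcomp : ∀ {w : M → EuclideanSpace ℝ (Fin m)},
      (∀ k, ContMDiff (𝓡 n) 𝓘(ℝ, ℝ) ∞ (fun x ↦ w x k)) → Continuous w := by
    intro w hw
    exact (PiLp.continuous_toLp 2 _).comp (continuous_pi fun k ↦ (hw k).continuous)
  have hLc : Continuous (weightedPLaplacian n p f v) :=
    (PiLp.continuous_toLp 2 _).comp (continuous_pi fun k ↦ hvc k)
  have hsplit : ∫ x, inner ℝ (weightedPLaplacian n p f v x) (w x - v x) ∂(weightedVolume n f) =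
      ∫ x, inner ℝ (w x) (weightedPLaplacian n p f v x) ∂(weightedVolume n f) -
        ∫ x, inner ℝ (v x) (weightedPLaplacian n p f v x) ∂(weightedVolume n f) := by
    rw [← integral_sub (integrable_weightedVolume hf.continuous ((hcomp hw).inner hLc))
      (integrable_weightedVolume hf.continuous ((hcomp hv).inner hLc))]
    refine integral_congr_ae (Eventually.of_forall fun x ↦ ?_)
    simp only
    rw [inner_sub_right, real_inner_comm, real_inner_comm (v x)]
  -- Green's formula turns the claim into the integral of `mul_crossDensity_le`.
  rw [hsplit, integral_inner_weightedPLaplacian hf hw hwd hwc,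
    integral_inner_weightedPLaplacian hf hv hvd hvc, integral_inner_weightedPLaplacian hf hw hvd hvc]
  have i1 := integrable_weightedVolume (n := n) hf.continuous (continuous_crossDensity (n := n) hw hwd)
  have i2 := integrable_weightedVolume (n := n) hf.continuous (continuous_crossDensity (n := n) hv hvd)
  have i3 := integrable_weightedVolume (n := n) hf.continuous (continuous_crossDensity (n := n) hw hvd)
  have h := integral_mono (i3.const_mul p) (i1.add (i2.const_mul (p - 1)))
    fun x ↦ mul_crossDensity_le hp w v x
  simp only [Pi.add_apply] at h
  rw [integral_const_mul, integral_add i1 (i2.const_mul (p - 1)), integral_const_mul] at h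
  linarith

end Energy

/-! ### Slices and time derivative of a function smooth on M × [a, b]. -/

section Solution

variable {n m : ℕ} {M : Type*} [TopologicalSpace M] [ChartedSpace (EuclideanSpace ℝ (Fin n)) M]
  [IsManifold (𝓡 n) ∞ M]

omit [IsManifold (𝓡 n) ∞ M] in
theorem contMDiff_slice {V : Type*} [NormedAddCommGroup V] [NormedSpace ℝ V] {a b : ℝ}
    {u : M → ℝ → V} (hu : ContMDiffOn ((𝓡 n).prod 𝓘(ℝ, ℝ)) 𝓘(ℝ, V) ∞
      (fun q : M × ℝ ↦ u q.1 q.2) (univ ×ˢ Icc a b)) {t : ℝ} (ht : t ∈ Icc a b) :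
    ContMDiff (𝓡 n) 𝓘(ℝ, V) ∞ (fun x ↦ u x t) :=
  hu.comp_contMDiff (contMDiff_id.prodMk contMDiff_const) fun x ↦ ⟨mem_univ x, ht⟩

theorem contDiffOn_symm_slice {V : Type*} [NormedAddCommGroup V] [NormedSpace ℝ V] {a b : ℝ}
    {u : M → ℝ → V} (hu : ContMDiffOn ((𝓡 n).prod 𝓘(ℝ, ℝ)) 𝓘(ℝ, V) ∞
      (fun q : M × ℝ ↦ u q.1 q.2) (univ ×ˢ Icc a b)) (x₀ : M) :
    ContDiffOn ℝ ∞ (fun q : EuclideanSpace ℝ (Fin n) × ℝ ↦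
      u ((extChartAt (𝓡 n) x₀).symm q.1) q.2) ((extChartAt (𝓡 n) x₀).target ×ˢ Icc a b) := by
  rw [← contMDiffOn_iff_contDiffOn]
  have h1 : ContMDiffOn 𝓘(ℝ, EuclideanSpace ℝ (Fin n) × ℝ) (𝓡 n) ∞
      (fun q : EuclideanSpace ℝ (Fin n) × ℝ ↦ (extChartAt (𝓡 n) x₀).symm q.1)
      ((extChartAt (𝓡 n) x₀).target ×ˢ Icc a b) :=
    (contMDiffOn_extChartAt_symm (I := 𝓡 n) (n := ∞) x₀).comp
      contDiff_fst.contMDiff.contMDiffOn fun q hq ↦ hq.1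
  have h2 : ContMDiffOn 𝓘(ℝ, EuclideanSpace ℝ (Fin n) × ℝ) 𝓘(ℝ, ℝ) ∞
      (fun q : EuclideanSpace ℝ (Fin n) × ℝ ↦ q.2)
      ((extChartAt (𝓡 n) x₀).target ×ˢ Icc a b) := contDiff_snd.contMDiff.contMDiffOn
  exact hu.comp (h1.prodMk h2) fun q hq ↦ ⟨mem_univ _, hq.2⟩

theorem hasDerivWithinAt_slice {V : Type*} [NormedAddCommGroup V] [NormedSpace ℝ V] {a b : ℝ}
    {u : M → ℝ → V} (hu : ContMDiffOn ((𝓡 n).prod 𝓘(ℝ, ℝ)) 𝓘(ℝ, V) ∞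
      (fun q : M × ℝ ↦ u q.1 q.2) (univ ×ˢ Icc a b)) {x₀ : M} {z : EuclideanSpace ℝ (Fin n)}
    (hz : z ∈ (extChartAt (𝓡 n) x₀).target) {t : ℝ} (ht : t ∈ Icc a b) :
    HasDerivWithinAt (u ((extChartAt (𝓡 n) x₀).symm z))
      (fderivWithin ℝ (fun q : EuclideanSpace ℝ (Fin n) × ℝ ↦
        u ((extChartAt (𝓡 n) x₀).symm q.1) q.2) ((extChartAt (𝓡 n) x₀).target ×ˢ Icc a b) (z, t)
        (0, 1)) (Icc a b) t := by
  have h1 := ((contDiffOn_symm_slice hu x₀).differentiableOn (by simp) (z, t)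
    ⟨hz, ht⟩).hasFDerivWithinAt
  have h2 : HasDerivWithinAt (fun s : ℝ ↦ (z, s)) ((0 : EuclideanSpace ℝ (Fin n)), (1 : ℝ))
      (Icc a b) t := (hasDerivWithinAt_const _ _ _).prodMk (hasDerivWithinAt_id _ _)
  exact h1.comp_hasDerivWithinAt t h2 fun s hs ↦ ⟨hz, hs⟩

/-- In a chart the time derivative is the joint derivative applied to (0, 1), and that derivative is
continuous up to the end times since a < b gives unique differentiability on target × [a, b]. -/
theorem continuousOn_derivWithin_slice {V : Type*} [NormedAddCommGroup V] [NormedSpace ℝ V]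
    {a b : ℝ} (hab : a < b) {u : M → ℝ → V}
    (hu : ContMDiffOn ((𝓡 n).prod 𝓘(ℝ, ℝ)) 𝓘(ℝ, V) ∞
      (fun q : M × ℝ ↦ u q.1 q.2) (univ ×ˢ Icc a b)) :
    ContinuousOn (fun q : M × ℝ ↦ derivWithin (u q.1) (Icc a b) q.2) (univ ×ˢ Icc a b) := by
  rintro ⟨x₀, t⟩ ⟨-, ht⟩
  have ho := isOpen_extChartAt_target (I := 𝓡 n) x₀
  have h1 := ((contDiffOn_symm_slice hu x₀).continuousOn_fderivWithin
    (ho.uniqueDiffOn.prod (uniqueDiffOn_Icc hab)) (by simp)).clm_apply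
    (continuousOn_const (c := ((0 : EuclideanSpace ℝ (Fin n)), (1 : ℝ))))
  have h2 : ContinuousOn (fun q : M × ℝ ↦ (extChartAt (𝓡 n) x₀ q.1, q.2))
      ((extChartAt (𝓡 n) x₀).source ×ˢ Icc a b) :=
    ((continuousOn_extChartAt x₀).comp continuousOn_fst fun q hq ↦ hq.1).prodMk continuousOn_snd
  have h3 := h1.comp h2 fun q hq ↦ ⟨(extChartAt (𝓡 n) x₀).map_source hq.1, hq.2⟩
  have h4 : ContinuousOn (fun q : M × ℝ ↦ derivWithin (u q.1) (Icc a b) q.2)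
      ((extChartAt (𝓡 n) x₀).source ×ˢ Icc a b) := by
    refine h3.congr fun q hq ↦ ?_
    have h5 := (hasDerivWithinAt_slice hu ((extChartAt (𝓡 n) x₀).map_source hq.1) hq.2).derivWithin
      (uniqueDiffOn_Icc hab q.2 hq.2)
    rw [(extChartAt (𝓡 n) x₀).left_inv hq.1] at h5
    exact h5
  refine (h4 (x₀, t) ⟨mem_extChartAt_source x₀, ht⟩).mono_of_mem_nhdsWithin ?_
  have h6 : (extChartAt (𝓡 n) x₀).source ×ˢ (univ : Set ℝ) ∈ 𝓝 (x₀, t) :=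
    prod_mem_nhds (extChartAt_source_mem_nhds x₀) univ_mem
  filter_upwards [mem_nhdsWithin_of_mem_nhds h6, self_mem_nhdsWithin] with q hq1 hq2
  exact ⟨hq1.1, hq2.2⟩

theorem hasDerivAt_slice {V : Type*} [NormedAddCommGroup V] [NormedSpace ℝ V] {a b : ℝ}
    {u : M → ℝ → V} (hu : ContMDiffOn ((𝓡 n).prod 𝓘(ℝ, ℝ)) 𝓘(ℝ, V) ∞
      (fun q : M × ℝ ↦ u q.1 q.2) (univ ×ˢ Icc a b)) (x : M) {t : ℝ} (ht : t ∈ Ioo a b) :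
    HasDerivAt (u x) (derivWithin (u x) (Icc a b) t) t := by
  have h1 := (hasDerivWithinAt_slice hu (mem_extChartAt_target x)
    (Ioo_subset_Icc_self ht)).differentiableWithinAt
  rw [extChartAt_to_inv] at h1
  exact h1.hasDerivWithinAt.hasDerivAt (Icc_mem_nhds ht.1 ht.2)

end Solution

end PFrequency

end

/-! ### The theorem: the abstract growth bound applied to the weighted p-Laplacian. -/

theorem corollary6 {n m : ℕ} {M : Type*} [TopologicalSpace M] [T2Space M] [CompactSpace M]
    [ChartedSpace (EuclideanSpace ℝ (Fin n)) M] [IsManifold (𝓡 n) ∞ M]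
    [RiemannianBundle (fun x : M ↦ TangentSpace (𝓡 n) x)]
    [IsContMDiffRiemannianBundle (𝓡 n) ∞ (EuclideanSpace ℝ (Fin n))
      (fun x : M ↦ TangentSpace (𝓡 n) x)]
    [MeasurableSpace M] [BorelSpace M]
    (f : M → ℝ) (hf : ContMDiff (𝓡 n) 𝓘(ℝ, ℝ) 2 f)
    (p : ℝ) (hp : 1 < p) (a b : ℝ) (hab : a < b)
    (η : ℝ → ℝ) (hη : ContDiffOn ℝ ∞ η (Icc a b))
    (u : M → ℝ → EuclideanSpace ℝ (Fin m)) (hu : PFrequency.IsPHeatSolution n p f η a b u) :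
    PFrequency.Ip n p f u b ≥ PFrequency.Ip n p f u a *
      Real.exp (p * (∫ t in a..b, η t) + p * PFrequency.Up n p f u a * (b - a)) := by
  open PFrequency in
  have hf1 : ContMDiff (𝓡 n) 𝓘(ℝ, ℝ) 1 f := hf.of_le (by norm_num)
  have hfin : IsFiniteMeasure (weightedVolume n f) :=
    (integrable_const_iff.1 (integrable_weightedVolume hf1.continuous
      (continuous_const (y := (1 : ℝ))))).resolve_left one_ne_zero
  have hslice : ∀ t ∈ Icc a b, ∀ k, ContMDiff (𝓡 n) 𝓘(ℝ, ℝ) ∞ (fun x ↦ u x t k) :=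
    fun t ht k ↦ (EuclideanSpace.proj k : EuclideanSpace ℝ (Fin m) →L[ℝ] ℝ).contMDiff.comp
      (contMDiff_slice hu.smooth ht)
  have huc := hu.smooth.continuousOn
  have hu'c := continuousOn_derivWithin_slice hab hu.smooth
  have hflux : ∀ t ∈ Icc a b, ∀ k, CoordDifferentiable (pFlux (n := n) p (fun y ↦ u y t) k) := by
    intro t ht k
    rcases le_or_gt 2 p with h2 | h2
    · exact coordDifferentiable_pFlux h2 (hslice t ht) k
    · exact CoordDifferentiable.of_contMDiff (hu.flux_contMDiff h2 t ht k)
  have hLc : ∀ t ∈ Icc a b, ∀ k,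
      Continuous (weightedDivergence f (pFlux (n := n) p (fun y ↦ u y t) k)) := by
    intro t ht k
    rcases le_or_gt 2 p with h2 | h2
    -- For p ≥ 2 the flux has only been shown differentiable; continuity of its divergence is read
    -- off from the equation, which here holds at every point.
    · have c1 : Continuous fun x ↦ u x t := continuous_slice huc ht
      have c2 : Continuous fun x ↦ derivWithin (u x) (Icc a b) t :=
        continuous_slice (H := fun x t ↦ derivWithin (u x) (Icc a b) t) hu'c ht
      have c3 : Continuous fun x ↦ ‖u x t‖ ^ (p - 2) :=
        c1.norm.rpow_const fun _ ↦ Or.inr (by linarith)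
      have hL : (fun x ↦ weightedDivergence f (pFlux (n := n) p (fun y ↦ u y t) k) x) = fun x ↦
          (‖u x t‖ ^ (p - 2) • derivWithin (u x) (Icc a b) t -
            (η t * ‖u x t‖ ^ (p - 2)) • u x t) k := by
        funext x
        have h := hu.equation t ht x (Or.inl h2)
        rw [← h, sub_sub_cancel]
        rfl
      have c4 := (EuclideanSpace.proj k : EuclideanSpace ℝ (Fin m) →L[ℝ] ℝ).continuous.comp
        ((c3.smul c2).sub ((continuous_const (y := η t)).mul c3 |>.smul c1))
      exact (congrArg Continuous hL).mpr c4
    · exact continuous_weightedDivergence hf1 (hu.flux_contMDiff h2 t ht k)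
  exact growth_of_evolution (μ := weightedVolume n f) hab hp hη.continuousOn huc hu'c
    (fun x t ht ↦ hasDerivAt_slice hu.smooth x ht)
    (L := fun t ↦ weightedPLaplacian n p f fun y ↦ u y t)
    (fun t ht ↦ (PiLp.continuous_toLp 2 _).comp (continuous_pi fun k ↦ hLc t ht k))
    hu.equation
    (fun h2 t ht ↦ by
      have h : ∀ᵐ x ∂(riemannianVolume n M), ∀ k, u x t = 0 →
          weightedDivergence f (pFlux (n := n) p (fun y ↦ u y t) k) x = 0 :=
        ae_all_iff.2 fun k ↦ ae_weightedDivergence_pFlux_eq_zero hf1 (hslice t ht) k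
          (hu.flux_contMDiff h2 t ht k)
      filter_upwards [(withDensity_absolutelyContinuous _ _).ae_le h] with x hx hx0
      ext k
      exact hx k hx0)
    fun s hs t ht ↦ integral_inner_weightedPLaplacian_le hf1 hp (hslice t ht) (hslice s hs)
      (hflux t ht) (hflux s hs) (hLc t ht) (hLc s hs)
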